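/- Setting. Let $S\subseteq\mathbb{R}^d$ be nonempty, compact and convex, and let $w^*:\mathbb{R}^d\to S$ be any oracle with $w^*(c)\in\arg\min_{w\in S}c^Tw$ for all $c$. Let $\mathcal{X}$ be a measurable (feature) space, $\mathcal{C}\subseteq\mathbb{R}^d$ the domain of the cost vectors, $\mathcal{D}$ a probability distribution of $(x,c)\in\mathcal{X}\times\mathbb{R}^d$ with $c\in\mathcal{C}$ almost surely, $n\ge 1$, and $\mathcal{H}$ a nonempty family of functions $f:\mathcal{X}\to\mathbb{R}^d$. Put $$\rho_2(\mathcal{C})=\sup_{c\in\mathcal{C}}\|c\|_2,\qquad \omega_S(c)=\max_{w\in S}c^Tw-\min_{w\in S}c^Tw,\qquad \omega_S(\mathcal{C})=\sup_{c\in\mathcal{C}}\omega_S(c),$$ $\ell_{\mathrm{SPO}}(\hat c,c)=c^T(w^*(\hat c)-w^*(c))$, and, for $\gamma>0$, let $\ell^\gamma_{\mathrm{SPO}}(\hat c,c)=\ell_{\mathrm{SPO}}(\hat c,c)$ if $\|\hat c\|_2>\gamma$ and $\ell^\gamma_{\mathrm{SPO}}(\hat c,c)=\frac{\|\hat c\|_2}{\gamma}\ell_{\mathrm{SPO}}(\hat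 c,c)+\bigl(1-\frac{\|\hat c\|_2}{\gamma}\bigr)\omega_S(c)$ if $\|\hat c\|_2\le\gamma$. Let $R_{\mathrm{SPO}}(f)=\mathbb{E}_{(x,c)\sim\mathcal{D}}[\ell_{\mathrm{SPO}}(f(x),c)]$ and, for a sample $(x_1,c_1),\dots,(x_n,c_n)$, $$\hat R^\gamma_{\mathrm{SPO}}(f)=\frac1n\sum_{i=1}^n\ell^\gamma_{\mathrm{SPO}}(f(x_i),c_i),\qquad \hat{\mathfrak R}^n_{\gamma\mathrm{SPO}}(\mathcal{H})=\mathbb{E}_\sigma\Bigl[\sup_{f\in\mathcal{H}}\frac1n\sum_{i=1}^n\sigma_i\,\ell^\gamma_{\mathrm{SPO}}(f(x_i),c_i)\Bigr],$$ $$\hat{\mathfrak R}^n(\mathcal{H})=\mathbb{E}_\sigma\Bigl[\sup_{f\in\mathcal{H}}\frac1n\sum_{i=1}^n\sum_{j=1}^d\sigma_{ij}f_j(x_i)\Bigr],\qquad \mathfrak R^n(\mathcal{H})=\mathbb{E}\bigl[\hat{\mathfrak R}^n(\mathcal{H})\bigr],$$ where the $\sigma_i$, $\sigma_{ij}$ are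 i.i.d. Rademacher signs and the last expectation is over an i.i.d. sample of size $n$ from $\mathcal{D}$. Suprema and expectations may be $+\infty$, with $0\cdot\infty=0$. Theorem. Suppose that $S$ is $\mu$-strongly convex with respect to the $\ell_2$-norm with $\mu>0$, i.e. for all $w_1,w_2\in S$ and $\lambda\in[0,1]$ the closed ball with center $\lambda w_1+(1-\lambda)w_2$ and radius $\frac\mu2\lambda(1-\lambda)\|w_1-w_2\|_2^2$ is contained in $S$; and let $\gamma>0$ be fixed. Then for every fixed sample $(x_1,c_1),\dots,(x_n,c_n)$ with all $c_i\in\mathcal{C}$, $$\hat{\mathfrak R}^n_{\gamma\mathrm{SPO}}(\mathcal{H})\le\frac{5\sqrt2\,\rho_2(\mathcal{C})\,\hat{\mathfrak R}^n(\mathcal{H})}{\gamma\mu}.$$ Furthermore, suppose that every $f\in\mathcal{H}$ is measurable and that, for every sample size $m$ and all signs $\sigma\in\{-1,1\}^m$, the supremum $\sup_{f\in\mathcal{H}}\sum_{i=1}^m\sigma_i\,\ell^\gamma_{\mathrm{SPO}}(f(x_i),c_i)$ is, up to null sets, a measurable function of the i.i.d. sample of size $m$. Then for every $\delta>0$, each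 of the following two statements holds with probability at least $1-\delta$ over an i.i.d. sample of size $n$ from $\mathcal{D}$: for all $f\in\mathcal{H}$, $$R_{\mathrm{SPO}}(f)\le\hat R^\gamma_{\mathrm{SPO}}(f)+\frac{10\sqrt2\,\rho_2(\mathcal{C})\,\mathfrak R^n(\mathcal{H})}{\gamma\mu}+\omega_S(\mathcal{C})\sqrt{\frac{\log(1/\delta)}{2n}};$$ for all $f\in\mathcal{H}$, $$R_{\mathrm{SPO}}(f)\le\hat R^\gamma_{\mathrm{SPO}}(f)+\frac{10\sqrt2\,\rho_2(\mathcal{C})\,\hat{\mathfrak R}^n(\mathcal{H})}{\gamma\mu}+3\,\omega_S(\mathcal{C})\sqrt{\frac{\log(2/\delta)}{2n}}.$$ (For $\delta\ge1$ the probability claims are void.) -/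

import Mathlib

open MeasureTheory

noncomputable section

namespace SPO

/-- The space of decisions and of cost vectors, `ℝ^d` with the `ℓ₂`-norm. -/
abbrev Vec (d : ℕ) : Type := EuclideanSpace ℝ (Fin d)

/-- A convex set `S` is `μ`-strongly convex (for the `ℓ₂`-norm) if around every convex combination
of two of its points it contains the closed ball of radius `(μ/2) t (1 - t) ‖w₁ - w₂‖²`. -/
def IsStronglyConvexSet {d : ℕ} (μ : ℝ) (S : Set (Vec d)) : Prop :=
  Convex ℝ S ∧ ∀ w₁ ∈ S, ∀ w₂ ∈ S, ∀ t ∈ Set.Icc (0 : ℝ) 1,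
    Metric.closedBall (t • w₁ + (1 - t) • w₂) (μ / 2 * t * (1 - t) * ‖w₁ - w₂‖ ^ 2) ⊆ S

/-- `w` is an optimization oracle for `S`: it maps every cost vector `c` to some minimizer of
`v ↦ cᵀ v` over `S`. -/
def IsOracle {d : ℕ} (S : Set (Vec d)) (w : Vec d → Vec d) : Prop :=
  ∀ c, w c ∈ S ∧ ∀ v ∈ S, inner ℝ c (w c) ≤ inner ℝ c v

/-- The SPO loss `cᵀ (w(ĉ) - w(c))` of the prediction `p = ĉ` for the true cost vector `c`. -/
def spoLoss {d : ℕ} (w : Vec d → Vec d) (p c : Vec d) : ℝ :=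
  inner ℝ c (w p - w c)

/-- The linear optimization gap `max_{v ∈ S} cᵀ v - min_{v ∈ S} cᵀ v`; it is used for nonempty
compact `S` only, where supremum and infimum are attained. -/
def gap {d : ℕ} (S : Set (Vec d)) (c : Vec d) : ℝ :=
  sSup ((fun v => inner ℝ c v) '' S) - sInf ((fun v => inner ℝ c v) '' S)

/-- `ω_S(C) = sup_{c ∈ C} ω_S(c)`, possibly `+∞`. -/
def gapSup {d : ℕ} (S C : Set (Vec d)) : EReal :=
  ⨆ c ∈ C, ((gap S c : ℝ) : EReal)

/-- `ρ₂(C) = sup_{c ∈ C} ‖c‖₂`, possibly `+∞`. -/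
def radius {d : ℕ} (C : Set (Vec d)) : EReal :=
  ⨆ c ∈ C, ((‖c‖ : ℝ) : EReal)

/-- The `γ`-margin SPO loss. -/
def marginLoss {d : ℕ} (S : Set (Vec d)) (w : Vec d → Vec d) (γ : ℝ) (p c : Vec d) : ℝ :=
  if γ < ‖p‖ then spoLoss w p c
  else ‖p‖ / γ * spoLoss w p c + (1 - ‖p‖ / γ) * gap S c

/-- The SPO risk of `f` under the distribution `D` of `(x, c)`. -/
def spoRisk {X : Type*} [MeasurableSpace X] {d : ℕ} (w : Vec d → Vec d)
    (D : Measure (X × Vec d)) (f : X → Vec d) : ℝ :=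
  ∫ z, spoLoss w (f z.1) z.2 ∂D

/-- The empirical `γ`-margin SPO risk of `f` on the sample `z`. -/
def empMarginRisk {X : Type*} {d n : ℕ} (S : Set (Vec d)) (w : Vec d → Vec d) (γ : ℝ)
    (z : Fin n → X × Vec d) (f : X → Vec d) : ℝ :=
  1 / (n : ℝ) * ∑ i, marginLoss S w γ (f (z i).1) (z i).2

/-- Expectation over independent Rademacher signs `(σ_i)_{i ∈ ι}`, i.e. over a uniformly
distributed `σ ∈ {1, -1}^ι`, of an extended-real function of the signs. -/
def signMean {ι : Type*} [Fintype ι] [DecidableEq ι] (F : (ι → ℤˣ) → EReal) : EReal :=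
  (∑ σ, F σ) / (((2 : ℝ) ^ Fintype.card ι : ℝ) : EReal)

/-- The empirical Rademacher complexity of the class `{(x, c) ↦ ℓ^γ(f(x), c) : f ∈ H}` of
`γ`-margin SPO losses on the sample `z`. -/
def empMarginRademacher {X : Type*} {d n : ℕ} (S : Set (Vec d)) (w : Vec d → Vec d) (γ : ℝ)
    (H : Set (X → Vec d)) (z : Fin n → X × Vec d) : EReal :=
  signMean fun σ : Fin n → ℤˣ => ⨆ f ∈ H,
    ((1 / (n : ℝ) * ∑ i, ((σ i : ℤ) : ℝ) * marginLoss S w γ (f (z i).1) (z i).2 : ℝ) : EReal)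

/-- The multivariate empirical Rademacher complexity of `H` on the features `x`; it is `+∞` if
the values of `H` on `x` are unbounded. -/
def empRademacher {X : Type*} {d n : ℕ} (H : Set (X → Vec d)) (x : Fin n → X) : EReal :=
  signMean fun σ : Fin n × Fin d → ℤˣ => ⨆ f ∈ H,
    ((1 / (n : ℝ) * ∑ i, ∑ j, ((σ (i, j) : ℤ) : ℝ) * f (x i) j : ℝ) : EReal)

/-- The expected multivariate Rademacher complexity: the expectation of the empirical one, which
is nonnegative for nonempty `H`, over an i.i.d. sample of size `n` from `D`. -/
def rademacher {X : Type*} [MeasurableSpace X] {d : ℕ} (n : ℕ) (D : Measure (X × Vec d))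
    (H : Set (X → Vec d)) : EReal :=
  ((∫⁻ z, (empRademacher H fun i => (z i).1).toENNReal
    ∂(Measure.pi fun _ : Fin n => D) : ENNReal) : EReal)

/-- The measurability convention for the loss class: for every sample size `m` and all signs, the
supremum over `H` in the Rademacher complexity of the margin losses is a measurable function
(modulo null sets) of the i.i.d. sample. It holds e.g. if `H` is countable, or has a countable
pointwise dense subset, and consists of measurable functions. -/
def HasMeasurableSups {X : Type*} [MeasurableSpace X] {d : ℕ} (S : Set (Vec d))
    (w : Vec d → Vec d) (γ : ℝ) (D : Measure (X × Vec d)) (H : Set (X → Vec d)) : Prop :=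
  ∀ (m : ℕ) (σ : Fin m → ℤˣ), AEMeasurable
    (fun z : Fin m → X × Vec d => ⨆ f ∈ H,
      ((∑ i, ((σ i : ℤ) : ℝ) * marginLoss S w γ (f (z i).1) (z i).2 : ℝ) : EReal))
    (Measure.pi fun _ : Fin m => D)

/-- The event `Q` has probability at least `p` (for an event that need not be measurable: it
contains a measurable event of probability at least `p`). -/
def HoldsWithProb {Ω : Type*} [MeasurableSpace Ω] (P : Measure Ω) (p : ℝ) (Q : Ω → Prop) : Prop :=
  ∃ A : Set Ω, MeasurableSet A ∧ ENNReal.ofReal p ≤ P A ∧ ∀ z ∈ A, Q z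

end SPO

end

/-! The bounds rest on one geometric fact: over a strongly convex set the minimizer of a linear
function is Lipschitz away from the origin, ‖w p − w q‖ ≤ 2‖p − q‖ / (μ(‖p‖ + ‖q‖))
(`oracle_dist_le`). The SPO loss is therefore singular in the prediction only near 0, and there the
margin loss damps it by the factor ‖p‖/γ. Hence the margin loss is Lipschitz in the prediction with
constant 3‖c‖/(γμ) (`marginLoss_lipschitz`).

A vector contraction inequality (`expect_iSup_signSum_le`) turns this into the bound for the
complexity of the loss class. Exchanging one scalar sign for d signs costs a Khintchine constant; an
elementary moment argument gives 16/9 instead of the sharp √2, which suffices because 3 · 16/9 is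
still below 5√2.

The generalization bounds combine ℓ_SPO ≤ ℓ^γ with McDiarmid's inequality and symmetrization by a
ghost sample. Only signed suprema of losses are assumed measurable, so the uniform deviation itself
need not be. It is dominated (up to a shift) by `ghostDeviation`, which averages a signed supremum
over 2n points. Partial averages are lower integrals (`lowerMean`), so that pointwise bounds survive
on the null set of nonmeasurable slices. Finally, losses are bounded only for costs in C, which need
not be measurable; `clippedLoss` removes a null set, and infinite values of ρ₂(C) and ω_S(C) are
treated apart. -/

namespace SPO

/-! ### Strong convexity: regularity of the oracle and of the margin loss -/

section Oracle

variable {d : ℕ} {S : Set (Vec d)} {w : Vec d → Vec d} {μ γ : ℝ}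

/-- A minimizer of c over S is compared with the lowest point, in direction −c, of the ball around t
w(c) + (1 − t) v. Dividing by 1 − t and letting t → 1 gives quadratic growth of the objective away
from the minimizer. -/
lemma IsStronglyConvexSet.le_inner_sub (hS : IsStronglyConvexSet μ S) (hμ : 0 ≤ μ)
    (hw : IsOracle S w) (c : Vec d) {v : Vec d} (hv : v ∈ S) :
    μ / 2 * ‖c‖ * ‖w c - v‖ ^ 2 ≤ inner ℝ c (v - w c) := by
  rcases eq_or_ne c 0 with rfl | hc
  · simp
  have hc' : 0 < ‖c‖ := norm_pos_iff.2 hc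
  have key : ∀ t : ℝ, 0 ≤ t → t < 1 →
      t * (μ / 2 * ‖c‖ * ‖w c - v‖ ^ 2) ≤ inner ℝ c (v - w c) := by
    intro t ht0 ht1
    set r : ℝ := μ / 2 * t * (1 - t) * ‖w c - v‖ ^ 2 with hr
    have hr0 : 0 ≤ r := by
      have : 0 ≤ 1 - t := by linarith
      positivity
    have hmem : t • w c + (1 - t) • v - (r * ‖c‖⁻¹) • c ∈ S := by
      refine hS.2 (w c) (hw c).1 v hv t ⟨ht0, ht1.le⟩ ?_
      rw [Metric.mem_closedBall, dist_eq_norm, sub_sub_cancel_left, norm_neg, norm_smul,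
        Real.norm_eq_abs, abs_of_nonneg (by positivity), inv_mul_cancel_right₀ hc'.ne']
    have h := (hw c).2 _ hmem
    rw [inner_sub_right, inner_add_right, inner_smul_right, inner_smul_right, inner_smul_right,
      real_inner_self_eq_norm_sq] at h
    have h2 : r * ‖c‖⁻¹ * ‖c‖ ^ 2 = r * ‖c‖ := by field_simp
    rw [h2] at h
    rw [inner_sub_right]
    have h3 : 0 < 1 - t := by linarith
    refine le_of_mul_le_mul_left ?_ h3
    have : (1 - t) * (t * (μ / 2 * ‖c‖ * ‖w c - v‖ ^ 2)) = r * ‖c‖ := by rw [hr]; ring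
    rw [this]
    linarith
  by_contra! hlt
  set a := μ / 2 * ‖c‖ * ‖w c - v‖ ^ 2 with ha
  have hb : 0 ≤ inner ℝ c (v - w c) := by
    rw [inner_sub_right]; linarith [(hw c).2 v hv]
  have ha0 : 0 < a := hb.trans_lt hlt
  -- A concrete t replaces the limit t → 1: with b the inner product and b < a, the choice t = (a +
  -- b)/(2a) < 1 gives t a = (a + b)/2 > b.
  have h := key ((a + inner ℝ c (v - w c)) / (2 * a)) (by positivity)
    (by rw [div_lt_one (by positivity)]; linarith)
  have h2 : (a + inner ℝ c (v - w c)) / (2 * a) * a = (a + inner ℝ c (v - w c)) / 2 := by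
    field_simp
  rw [h2] at h
  linarith

/-- Quadratic growth at w p and at w q, added up, bounds the inner product of p − q with w q − w p
from below; Cauchy–Schwarz bounds it from above, and one factor ‖w p − w q‖ cancels. -/
lemma IsStronglyConvexSet.oracle_dist_le (hS : IsStronglyConvexSet μ S) (hμ : 0 ≤ μ)
    (hw : IsOracle S w) (p q : Vec d) :
    μ / 2 * (‖p‖ + ‖q‖) * ‖w p - w q‖ ≤ ‖p - q‖ := by
  rcases (norm_nonneg (w p - w q)).eq_or_lt with h0 | h0
  · rw [← h0]; simp
  have h1 := hS.le_inner_sub hμ hw p (hw q).1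
  have h2 := hS.le_inner_sub hμ hw q (hw p).1
  rw [norm_sub_rev (w q)] at h2
  have h3 : inner ℝ p (w q - w p) + inner ℝ q (w p - w q) = inner ℝ (p - q) (w q - w p) := by
    simp only [inner_sub_left, inner_sub_right]; ring
  have h4 := real_inner_le_norm (p - q) (w q - w p)
  rw [norm_sub_rev (w q)] at h4
  refine le_of_mul_le_mul_right ?_ h0
  nlinarith

lemma IsOracle.sInf_eq (hw : IsOracle S w) (c : Vec d) :
    sInf ((fun v => inner ℝ c v) '' S) = inner ℝ c (w c) :=
  IsLeast.csInf_eq ⟨⟨_, (hw c).1, rfl⟩, by rintro _ ⟨v, hv, rfl⟩; exact (hw c).2 v hv⟩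

lemma IsOracle.sSup_eq (hw : IsOracle S w) (c : Vec d) :
    sSup ((fun v => inner ℝ c v) '' S) = inner ℝ c (w (-c)) :=
  IsGreatest.csSup_eq ⟨⟨_, (hw (-c)).1, rfl⟩, by
    rintro _ ⟨v, hv, rfl⟩
    have := (hw (-c)).2 v hv
    simp only [inner_neg_left] at this
    simp only
    linarith⟩

lemma IsOracle.gap_eq (hw : IsOracle S w) (c : Vec d) :
    gap S c = inner ℝ c (w (-c) - w c) := by
  rw [gap, hw.sSup_eq, hw.sInf_eq, inner_sub_right]

lemma IsOracle.spoLoss_nonneg (hw : IsOracle S w) (p c : Vec d) : 0 ≤ spoLoss w p c := by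
  rw [spoLoss, inner_sub_right]; linarith [(hw c).2 _ (hw p).1]

lemma IsOracle.spoLoss_le_gap (hw : IsOracle S w) (p c : Vec d) : spoLoss w p c ≤ gap S c := by
  rw [spoLoss, hw.gap_eq, inner_sub_right, inner_sub_right]
  have := (hw (-c)).2 _ (hw p).1
  simp only [inner_neg_left] at this
  linarith

lemma IsOracle.gap_nonneg (hw : IsOracle S w) (c : Vec d) : 0 ≤ gap S c :=
  (hw.spoLoss_nonneg c c).trans (hw.spoLoss_le_gap c c)

/-- The two cases merge into one convex combination of loss and gap, with weight min(‖p‖/γ, 1). -/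
lemma marginLoss_eq (hγ : 0 < γ) (p c : Vec d) :
    marginLoss S w γ p c =
      min (‖p‖ / γ) 1 * spoLoss w p c + (1 - min (‖p‖ / γ) 1) * gap S c := by
  unfold marginLoss
  split_ifs with h
  · rw [min_eq_right ((one_le_div hγ).2 h.le)]; ring
  · rw [min_eq_left ((div_le_one hγ).2 (not_lt.1 h))]

lemma IsOracle.spoLoss_le_marginLoss (hw : IsOracle S w) (hγ : 0 < γ) (p c : Vec d) :
    spoLoss w p c ≤ marginLoss S w γ p c := by
  rw [marginLoss_eq hγ]
  have h1 := hw.spoLoss_le_gap p c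
  have h2 := min_le_right (‖p‖ / γ) 1
  nlinarith

lemma IsOracle.marginLoss_le_gap (hw : IsOracle S w) (hγ : 0 < γ) (p c : Vec d) :
    marginLoss S w γ p c ≤ gap S c := by
  rw [marginLoss_eq hγ]
  have h1 := hw.spoLoss_le_gap p c
  have h2 : 0 ≤ min (‖p‖ / γ) 1 := by positivity
  nlinarith

lemma IsOracle.marginLoss_nonneg (hw : IsOracle S w) (hγ : 0 < γ) (p c : Vec d) :
    0 ≤ marginLoss S w γ p c :=
  (hw.spoLoss_nonneg p c).trans (hw.spoLoss_le_marginLoss hγ p c)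

/-- The maximizer of c is w(−c), so this is the oracle estimate for the pair −c, c. -/
lemma IsStronglyConvexSet.gap_le (hS : IsStronglyConvexSet μ S) (hμ : 0 < μ)
    (hw : IsOracle S w) (c : Vec d) : μ * gap S c ≤ 2 * ‖c‖ := by
  rcases eq_or_ne c 0 with rfl | hc
  · simp [hw.gap_eq]
  have hc' : 0 < ‖c‖ := norm_pos_iff.2 hc
  have h := hS.oracle_dist_le hμ.le hw (-c) c
  rw [norm_neg, ← neg_add', norm_neg, ← two_smul ℝ c, norm_smul, Real.norm_two] at h
  have h1 : μ * ‖w (-c) - w c‖ ≤ 2 := by nlinarith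
  rw [hw.gap_eq]
  have h2 := real_inner_le_norm c (w (-c) - w c)
  nlinarith

/-- Multiplying by ‖p‖ removes the singularity at 0; the last factor is at most 1 when p is the
shorter of the two vectors. -/
lemma IsStronglyConvexSet.abs_spoLoss_sub_le (hS : IsStronglyConvexSet μ S) (hμ : 0 < μ)
    (hw : IsOracle S w) (p q c : Vec d) :
    μ * ‖p‖ * |spoLoss w q c - spoLoss w p c| ≤ ‖c‖ * (‖p - q‖ * (2 * ‖p‖ / (‖p‖ + ‖q‖))) := by
  have h1 : |spoLoss w q c - spoLoss w p c| ≤ ‖c‖ * ‖w p - w q‖ := by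
    have : spoLoss w q c - spoLoss w p c = inner ℝ c (w q - w p) := by
      simp only [spoLoss, inner_sub_right]; ring
    rw [this, norm_sub_rev]
    exact abs_real_inner_le_norm _ _
  rcases eq_or_ne p 0 with rfl | hp
  · simp
  have hp : 0 < ‖p‖ := norm_pos_iff.2 hp
  have hs : 0 < ‖p‖ + ‖q‖ := by positivity
  have h2 := hS.oracle_dist_le hμ.le hw p q
  have h3 : μ * ‖p‖ * ‖w p - w q‖ ≤ ‖p - q‖ * (2 * ‖p‖ / (‖p‖ + ‖q‖)) := by
    rw [mul_div_assoc', le_div_iff₀ hs]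
    nlinarith
  calc μ * ‖p‖ * |spoLoss w q c - spoLoss w p c| ≤ μ * ‖p‖ * (‖c‖ * ‖w p - w q‖) := by gcongr
    _ = ‖c‖ * (μ * ‖p‖ * ‖w p - w q‖) := by ring
    _ ≤ _ := by gcongr

lemma IsStronglyConvexSet.marginLoss_lipschitz (hS : IsStronglyConvexSet μ S) (hμ : 0 < μ)
    (hw : IsOracle S w) (hγ : 0 < γ) (p q c : Vec d) :
    |marginLoss S w γ p c - marginLoss S w γ q c| ≤ 3 * ‖c‖ / (γ * μ) * ‖p - q‖ := by
  wlog hpq : ‖p‖ ≤ ‖q‖ generalizing p q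
  · rw [abs_sub_comm, norm_sub_rev]; exact this q p (not_le.1 hpq).le
  rw [abs_sub_comm, marginLoss_eq hγ, marginLoss_eq hγ]
  set a := min (‖p‖ / γ) 1 with ha
  set b := min (‖q‖ / γ) 1 with hb
  have ha0 : 0 ≤ a := by positivity
  have hap : a * γ ≤ ‖p‖ := by
    rw [← le_div_iff₀ hγ]; exact min_le_left _ _
  have hab : a ≤ b := min_le_min_right _ (by gcongr)
  have hba : b - a ≤ ‖p - q‖ / γ := by
    have h1 : b ≤ ‖q‖ / γ := min_le_left _ _
    have h2 : b ≤ 1 := min_le_right _ _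
    have h3 : ‖q‖ - ‖p‖ ≤ ‖p - q‖ := by rw [norm_sub_rev]; exact norm_sub_norm_le _ _
    have h4 : ‖q‖ / γ - ‖p‖ / γ ≤ ‖p - q‖ / γ := by rw [← sub_div]; gcongr
    have h5 : 0 ≤ ‖p - q‖ / γ := by positivity
    rcases min_choice (‖p‖ / γ) 1 with h | h
    · rw [ha, h]; linarith
    · rw [ha, h]; linarith
  -- The weight a of the shorter vector multiplies the change of the loss, so a γ ≤ ‖p‖ absorbs the
  -- singularity and this term contributes 1 to the constant. The change of weight multiplies at
  -- most the gap, which is at most 2‖c‖/μ, and contributes 2.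
  have e : b * spoLoss w q c + (1 - b) * gap S c - (a * spoLoss w p c + (1 - a) * gap S c)
      = a * (spoLoss w q c - spoLoss w p c) - (b - a) * (gap S c - spoLoss w q c) := by ring
  have hg := hS.gap_le hμ hw c
  have hl := hS.abs_spoLoss_sub_le hμ hw p q c
  have hfrac : 2 * ‖p‖ / (‖p‖ + ‖q‖) ≤ 1 :=
    div_le_one_of_le₀ (by linarith) (by positivity)
  have h1 : a * γ * μ * |spoLoss w q c - spoLoss w p c| ≤ ‖c‖ * ‖p - q‖ := by
    calc a * γ * μ * |spoLoss w q c - spoLoss w p c|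
        ≤ ‖p‖ * μ * |spoLoss w q c - spoLoss w p c| := by gcongr
      _ = μ * ‖p‖ * |spoLoss w q c - spoLoss w p c| := by ring
      _ ≤ ‖c‖ * (‖p - q‖ * (2 * ‖p‖ / (‖p‖ + ‖q‖))) := hl
      _ ≤ ‖c‖ * (‖p - q‖ * 1) := by gcongr
      _ = _ := by ring
  have h2 : (b - a) * γ * (μ * (gap S c - spoLoss w q c)) ≤ ‖p - q‖ * (2 * ‖c‖) := by
    rw [le_div_iff₀ hγ] at hba
    have h3 : μ * (gap S c - spoLoss w q c) ≤ 2 * ‖c‖ := by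
      nlinarith [hw.spoLoss_nonneg q c]
    have h4 : 0 ≤ μ * (gap S c - spoLoss w q c) :=
      mul_nonneg hμ.le (by linarith [hw.spoLoss_le_gap q c])
    exact mul_le_mul hba h3 h4 (norm_nonneg _)
  have h5 : |(b - a) * (gap S c - spoLoss w q c)| = (b - a) * (gap S c - spoLoss w q c) :=
    abs_of_nonneg (mul_nonneg (by linarith) (by linarith [hw.spoLoss_le_gap q c]))
  rw [e, div_mul_eq_mul_div, le_div_iff₀ (by positivity)]
  calc |a * (spoLoss w q c - spoLoss w p c) - (b - a) * (gap S c - spoLoss w q c)| * (γ * μ)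
      ≤ (a * |spoLoss w q c - spoLoss w p c| + (b - a) * (gap S c - spoLoss w q c))
          * (γ * μ) := by
        gcongr
        refine (abs_sub _ _).trans (le_of_eq ?_)
        rw [h5, abs_mul, abs_of_nonneg ha0]
    _ ≤ 3 * ‖c‖ * ‖p - q‖ := by linarith

/-- The oracle is continuous off the origin, and its arbitrary value at the single point 0 does no
harm to measurability. -/
lemma IsStronglyConvexSet.measurable_oracle (hS : IsStronglyConvexSet μ S) (hμ : 0 < μ)
    (hw : IsOracle S w) : Measurable w := by
  have hcont : ContinuousOn w {c | c ≠ 0} := by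
    intro p hp
    have hp' : 0 < ‖p‖ := norm_pos_iff.2 hp
    refine ContinuousAt.continuousWithinAt ?_
    rw [ContinuousAt, tendsto_iff_norm_sub_tendsto_zero]
    have hlim : Filter.Tendsto (fun q => 2 / (μ * ‖p‖) * ‖q - p‖) (nhds p) (nhds 0) := by
      have : Continuous fun q : Vec d => 2 / (μ * ‖p‖) * ‖q - p‖ := by fun_prop
      simpa using this.tendsto p
    refine squeeze_zero (fun _ => norm_nonneg _) (fun q => ?_) hlim
    have h := hS.oracle_dist_le hμ.le hw q p
    rw [div_mul_eq_mul_div, le_div_iff₀ (by positivity)]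
    have h2 : 0 ≤ μ * ‖q‖ * ‖w q - w p‖ := by positivity
    nlinarith
  have hm : MeasurableSet {c : Vec d | c ≠ 0} := (measurableSet_singleton 0).compl
  refine measurable_of_restrict_of_restrict_compl hm ?_ ?_
  · exact hcont.domRestrict.measurable
  · have hconst : ({c : Vec d | c ≠ 0}ᶜ).domRestrict w = fun _ => w 0 := by
      funext x
      have hx : (x : Vec d) = 0 := by simpa using x.2
      rw [Set.domRestrict_apply, hx]
    rw [hconst]
    exact measurable_const

lemma IsStronglyConvexSet.measurable_marginLoss (hS : IsStronglyConvexSet μ S) (hμ : 0 < μ)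
    (hw : IsOracle S w) (hγ : 0 < γ) :
    Measurable fun z : Vec d × Vec d => marginLoss S w γ z.1 z.2 := by
  have hwm := hS.measurable_oracle hμ hw
  simp only [marginLoss_eq hγ, hw.gap_eq, spoLoss]
  fun_prop

end Oracle

/-! ### Moments of Rademacher sums and a Khintchine inequality -/

section Signs

open Finset
open scoped BigOperators

lemma expect_int_units (F : ℤˣ → ℝ) : 𝔼 ε, F ε = (F 1 + F (-1)) / 2 := by
  rw [Fintype.expect_eq_sum_div_card, UnitsInt.univ]
  simp

lemma expect_fin_succ_cons {α : Type*} [Fintype α] {n : ℕ} (F : (Fin (n + 1) → α) → ℝ) :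
    𝔼 σ, F σ = 𝔼 ε : α, 𝔼 σ : Fin n → α, F (Fin.cons ε σ) := by
  rw [← Fintype.expect_equiv (Fin.consEquiv fun _ : Fin (n + 1) => α)
    (fun p => F (Fin.cons p.1 p.2)) F (fun _ => rfl), ← univ_product_univ, expect_product]

/-- The Rademacher sum with coefficients `a`. -/
def signSum {ι : Type*} [Fintype ι] (a : ι → ℝ) (σ : ι → ℤˣ) : ℝ := ∑ i, ((σ i : ℤ) : ℝ) * a i

lemma signSum_cons {n : ℕ} (a : Fin (n + 1) → ℝ) (ε : ℤˣ) (σ : Fin n → ℤˣ) :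
    signSum a (Fin.cons ε σ) = ((ε : ℤ) : ℝ) * a 0 + signSum (Fin.tail a) σ := by
  simp [signSum, Fin.sum_univ_succ, Fin.tail]

lemma signSum_neg {ι : Type*} [Fintype ι] (a : ι → ℝ) (σ : ι → ℤˣ) :
    signSum a (-σ) = -signSum a σ := by
  simp [signSum]

lemma signSum_sub {ι : Type*} [Fintype ι] (a b : ι → ℝ) (σ : ι → ℤˣ) :
    signSum (a - b) σ = signSum a σ - signSum b σ := by
  simp [signSum, mul_sub, sum_sub_distrib]

lemma signSum_smul {ι : Type*} [Fintype ι] (c : ℝ) (a : ι → ℝ) (σ : ι → ℤˣ) :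
    signSum (c • a) σ = c * signSum a σ := by
  simp only [signSum, mul_sum, Pi.smul_apply, smul_eq_mul]
  exact sum_congr rfl fun i _ => by ring

lemma abs_signSum_le {ι : Type*} [Fintype ι] (a : ι → ℝ) (σ : ι → ℤˣ) :
    |signSum a σ| ≤ ∑ i, |a i| := by
  refine (abs_sum_le_sum_abs _ _).trans (le_of_eq (sum_congr rfl fun i _ => ?_))
  rcases Int.units_eq_one_or (σ i) with h | h <;> simp [h]

lemma expect_neg_eq {ι : Type*} [Fintype ι] [DecidableEq ι] (F : (ι → ℤˣ) → ℝ) :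
    𝔼 σ, F (-σ) = 𝔼 σ, F σ :=
  Fintype.expect_equiv (Equiv.neg _) _ _ fun _ => rfl

lemma expect_signSum {ι : Type*} [Fintype ι] [DecidableEq ι] (a : ι → ℝ) :
    𝔼 σ, signSum a σ = 0 := by
  have h := expect_neg_eq (signSum a)
  simp only [signSum_neg, expect_neg_distrib] at h
  linarith

lemma expect_signSum_sq {n : ℕ} (a : Fin n → ℝ) : 𝔼 σ, signSum a σ ^ 2 = ∑ i, a i ^ 2 := by
  induction n with
  | zero => simp [signSum]
  | succ n ih =>
    rw [expect_fin_succ_cons, expect_int_units, Fin.sum_univ_succ]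
    simp only [signSum_cons]
    rw [← expect_add_distrib]
    have : ∀ σ : Fin n → ℤˣ, ((((1 : ℤˣ) : ℤ) : ℝ) * a 0 + signSum (Fin.tail a) σ) ^ 2 +
        ((((-1 : ℤˣ) : ℤ) : ℝ) * a 0 + signSum (Fin.tail a) σ) ^ 2
        = 2 * a 0 ^ 2 + 2 * signSum (Fin.tail a) σ ^ 2 := by
      intro σ; push_cast; ring
    simp only [this]
    simp only [expect_add_distrib, ← mul_expect, ih, expect_const univ_nonempty, Fin.tail]
    ring

/-- Averaging over the first sign kills the odd powers. With s the sum of the remaining squares, the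
induction adds a₀⁴ + 6 a₀² s, while the right side grows by 3 a₀⁴ + 6 a₀² s. -/
lemma expect_signSum_pow_four_le {n : ℕ} (a : Fin n → ℝ) :
    𝔼 σ, signSum a σ ^ 4 ≤ 3 * (∑ i, a i ^ 2) ^ 2 := by
  induction n with
  | zero => simp [signSum]
  | succ n ih =>
    rw [expect_fin_succ_cons, expect_int_units, Fin.sum_univ_succ]
    simp only [signSum_cons]
    rw [← expect_add_distrib]
    have : ∀ σ : Fin n → ℤˣ, ((((1 : ℤˣ) : ℤ) : ℝ) * a 0 + signSum (Fin.tail a) σ) ^ 4 +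
        ((((-1 : ℤˣ) : ℤ) : ℝ) * a 0 + signSum (Fin.tail a) σ) ^ 4
        = 2 * a 0 ^ 4 + 12 * a 0 ^ 2 * signSum (Fin.tail a) σ ^ 2
          + 2 * signSum (Fin.tail a) σ ^ 4 := by
      intro σ; push_cast; ring
    simp only [this]
    simp only [expect_add_distrib, ← mul_expect, expect_signSum_sq, expect_const univ_nonempty]
    have h := ih (Fin.tail a)
    simp only [Fin.tail] at h ⊢
    nlinarith [sq_nonneg (a 0 ^ 2)]

/-- A Khintchine inequality, with a constant that is not optimal. -/
lemma norm_le_expect_abs_signSum {d : ℕ} (v : Vec d) :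
    ‖v‖ ≤ 16 / 9 * 𝔼 σ, |signSum v σ| := by
  rcases eq_or_ne v 0 with rfl | hv
  · simp [signSum]
  have hv : 0 < ‖v‖ := norm_pos_iff.2 hv
  have hs : ∑ i, v i ^ 2 = ‖v‖ ^ 2 := by rw [EuclideanSpace.real_norm_sq_eq]
  -- An even quartic minorant of |y|, touching it at |y| = 2‖v‖: the difference of the two sides is
  -- |y| (|y| − 2‖v‖)² (|y| + 4‖v‖) / 16. In expectation the minorant is at least (3/4 − 3/16)‖v‖⁴ =
  -- (9/16)‖v‖⁴.
  have hp : ∀ y : ℝ, 3 / 4 * ‖v‖ ^ 2 * y ^ 2 - y ^ 4 / 16 ≤ ‖v‖ ^ 3 * |y| := by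
    intro y
    rw [← sq_abs y, ← Even.pow_abs (by decide : Even 4) y]
    have h0 := abs_nonneg y
    have : 0 ≤ |y| * ((|y| - 2 * ‖v‖) ^ 2 * (|y| + 4 * ‖v‖)) := by positivity
    nlinarith
  have h1 : 𝔼 σ, (3 / 4 * ‖v‖ ^ 2 * signSum v σ ^ 2 - signSum v σ ^ 4 / 16)
      ≤ 𝔼 σ, ‖v‖ ^ 3 * |signSum v σ| := expect_le_expect fun σ _ => hp _
  rw [expect_sub_distrib, ← mul_expect, ← mul_expect, ← expect_div, expect_signSum_sq, hs] at h1
  have h2 := expect_signSum_pow_four_le v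
  rw [hs] at h2
  have h3 : ‖v‖ ^ 3 * ‖v‖ ≤ ‖v‖ ^ 3 * (16 / 9 * 𝔼 σ, |signSum v σ|) := by nlinarith
  exact le_of_mul_le_mul_left h3 (by positivity)

end Signs

/-! ### Vector-valued contraction of Rademacher averages -/

section Contraction

open Finset
open scoped BigOperators

/-- A bounded real function. -/
def IsBdd {ι : Type*} (u : ι → ℝ) : Prop := ∃ M, ∀ f, |u f| ≤ M

lemma IsBdd.bddAbove {ι : Type*} {u : ι → ℝ} (h : IsBdd u) : BddAbove (Set.range u) := by
  obtain ⟨M, hM⟩ := h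
  exact ⟨M, by rintro _ ⟨f, rfl⟩; exact (le_abs_self _).trans (hM f)⟩

lemma IsBdd.add {ι : Type*} {u v : ι → ℝ} (hu : IsBdd u) (hv : IsBdd v) :
    IsBdd fun f => u f + v f := by
  obtain ⟨M, hM⟩ := hu
  obtain ⟨N, hN⟩ := hv
  exact ⟨M + N, fun f => (abs_add_le _ _).trans (add_le_add (hM f) (hN f))⟩

lemma IsBdd.const_mul {ι : Type*} {u : ι → ℝ} (hu : IsBdd u) (c : ℝ) :
    IsBdd fun f => c * u f := by
  obtain ⟨M, hM⟩ := hu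
  exact ⟨|c| * M, fun f => by rw [abs_mul]; gcongr; exact hM f⟩

lemma IsBdd.sum {ι κ : Type*} [Fintype κ] {u : κ → ι → ℝ} (hu : ∀ k, IsBdd (u k)) :
    IsBdd fun f => ∑ k, u k f := by
  choose M hM using hu
  exact ⟨∑ k, M k, fun f => (abs_sum_le_sum_abs _ _).trans (sum_le_sum fun k _ => hM k f)⟩

lemma IsBdd.signSum {ι κ : Type*} [Fintype κ] {u : κ → ι → ℝ} (hu : ∀ k, IsBdd (u k))
    (σ : κ → ℤˣ) : IsBdd fun f => signSum (fun k => u k f) σ :=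
  IsBdd.sum fun k => (hu k).const_mul _

variable {ι : Type*} [Nonempty ι] {d : ℕ}

/-- The exchange of a single sign. The average over ε is half a supremum over pairs (f, g), in which
ψ f − ψ g is replaced by ‖φ f − φ g‖ and then by Khintchine's average of |signSum|. For each σ, the
sign of that sum decides which of f and g competes in the supremum for σ and which in the one for
−σ. -/
lemma expect_iSup_add_le {A ψ : ι → ℝ} {φ : ι → Vec d} (hA : IsBdd A)
    (hφ : ∀ j, IsBdd fun f => φ f j) (hψφ : ∀ f g, |ψ f - ψ g| ≤ ‖φ f - φ g‖) :
    𝔼 ε : ℤˣ, ⨆ f, (A f + ((ε : ℤ) : ℝ) * ψ f)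
      ≤ 𝔼 σ, ⨆ f, (A f + 16 / 9 * signSum (φ f) σ) := by
  set m : (Fin d → ℤˣ) → ℝ := fun σ => ⨆ f, (A f + 16 / 9 * signSum (φ f) σ) with hm
  have hle : ∀ σ f, A f + 16 / 9 * signSum (φ f) σ ≤ m σ := fun σ f =>
    le_ciSup (hA.add ((IsBdd.signSum hφ σ).const_mul (16 / 9))).bddAbove f
  have key : ∀ f g, (A f + ψ f) + (A g - ψ g) ≤ 2 * 𝔼 σ, m σ := by
    intro f g
    have h1 : (A f + ψ f) + (A g - ψ g) ≤ A f + A g + ‖φ f - φ g‖ := by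
      linarith [le_abs_self (ψ f - ψ g), hψφ f g]
    have h2 := norm_le_expect_abs_signSum (φ f - φ g)
    have h3 : 𝔼 σ, (A f + A g + 16 / 9 * |signSum (φ f - φ g) σ|) ≤ 𝔼 σ, (m σ + m (-σ)) := by
      refine expect_le_expect fun σ _ => ?_
      have e : signSum (φ f - φ g) σ = signSum (φ f) σ - signSum (φ g) σ :=
        signSum_sub (φ f) (φ g) σ
      have a1 := hle σ f
      have a2 := hle σ g
      have a3 := hle (-σ) f
      have a4 := hle (-σ) g
      rw [signSum_neg] at a3 a4
      rw [e]
      rcases abs_choice (signSum (φ f) σ - signSum (φ g) σ) with h | h <;> rw [h] <;> linarith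
    rw [expect_add_distrib, expect_const univ_nonempty, ← mul_expect, expect_add_distrib,
      expect_neg_eq m] at h3
    linarith
  rw [expect_int_units]
  have h1 : (⨆ f, (A f + ψ f)) + ⨆ g, (A g - ψ g) ≤ 2 * 𝔼 σ, m σ := by
    rw [← le_sub_iff_add_le]
    refine ciSup_le fun f => ?_
    rw [le_sub_iff_add_le, ← le_sub_iff_add_le']
    exact ciSup_le fun g => by linarith [key f g]
  have e1 : (fun f => A f + (((1 : ℤˣ) : ℤ) : ℝ) * ψ f) = fun f => A f + ψ f := by
    funext f; simp
  have e2 : (fun f => A f + (((-1 : ℤˣ) : ℤ) : ℝ) * ψ f) = fun f => A f - ψ f := by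
    funext f; simp; ring
  rw [iSup_congr fun f => congrFun e1 f, iSup_congr fun f => congrFun e2 f]
  linarith

/-- Contraction of Rademacher averages for compositions with Lipschitz functions of vector-valued
functions. -/
lemma expect_iSup_signSum_le {n : ℕ} {A : ι → ℝ} {ψ : Fin n → ι → ℝ} {φ : Fin n → ι → Vec d}
    (hA : IsBdd A) (hψ : ∀ i, IsBdd (ψ i)) (hφ : ∀ i j, IsBdd fun f => φ i f j)
    (hψφ : ∀ i f g, |ψ i f - ψ i g| ≤ ‖φ i f - φ i g‖) :
    𝔼 ε, ⨆ f, (A f + signSum (fun i => ψ i f) ε)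
      ≤ 𝔼 σ : Fin n → Fin d → ℤˣ, ⨆ f, (A f + ∑ i, 16 / 9 * signSum (φ i f) (σ i)) := by
  -- The offset A is arbitrary so that it can absorb the terms already peeled off, first with the
  -- scalar sign and then with the vector of signs.
  induction n generalizing A with
  | zero => simp [signSum]
  | succ n ih =>
    rw [expect_fin_succ_cons, expect_fin_succ_cons]
    calc 𝔼 ε : ℤˣ, 𝔼 η : Fin n → ℤˣ, ⨆ f, (A f + signSum (fun i => ψ i f) (Fin.cons ε η))
        = 𝔼 ε : ℤˣ, 𝔼 η : Fin n → ℤˣ, ⨆ f, ((A f + ((ε : ℤ) : ℝ) * ψ 0 f)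
            + signSum (fun i => ψ (Fin.succ i) f) η) := by
          refine expect_congr rfl fun ε _ => expect_congr rfl fun η _ => iSup_congr fun f => ?_
          rw [signSum_cons, ← add_assoc]
          rfl
      _ ≤ 𝔼 ε : ℤˣ, 𝔼 σ : Fin n → Fin d → ℤˣ, ⨆ f, ((A f + ((ε : ℤ) : ℝ) * ψ 0 f)
            + ∑ i, 16 / 9 * signSum (φ (Fin.succ i) f) (σ i)) :=
          expect_le_expect fun ε _ => ih (hA.add ((hψ 0).const_mul _))
            (fun i => hψ i.succ) (fun i => hφ i.succ) fun i => hψφ i.succ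
      _ = 𝔼 σ : Fin n → Fin d → ℤˣ, 𝔼 ε : ℤˣ, ⨆ f,
            ((A f + ∑ i, 16 / 9 * signSum (φ (Fin.succ i) f) (σ i))
              + ((ε : ℤ) : ℝ) * ψ 0 f) := by
          rw [expect_comm]
          refine expect_congr rfl fun ε _ => expect_congr rfl fun η _ => iSup_congr fun f => ?_
          ring
      _ ≤ 𝔼 σ : Fin n → Fin d → ℤˣ, 𝔼 τ : Fin d → ℤˣ, ⨆ f,
            ((A f + ∑ i, 16 / 9 * signSum (φ (Fin.succ i) f) (σ i))
              + 16 / 9 * signSum (φ 0 f) τ) :=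
          expect_le_expect fun σ _ => expect_iSup_add_le
            (hA.add (IsBdd.sum fun i => (IsBdd.signSum (hφ i.succ) _).const_mul _)) (hφ 0) (hψφ 0)
      _ = _ := by
          rw [expect_comm]
          refine expect_congr rfl fun ε _ => expect_congr rfl fun η _ => iSup_congr fun f => ?_
          simp only [Fin.sum_univ_succ, Fin.cons_zero, Fin.cons_succ]
          ring

end Contraction

/-! ### Empirical complexity of the margin losses -/

section EmpiricalComplexity

open Finset
open scoped BigOperators

lemma coe_sum {ι : Type*} (s : Finset ι) (F : ι → ℝ) :
    ((∑ i ∈ s, F i : ℝ) : EReal) = ∑ i ∈ s, (F i : EReal) := by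
  classical
  induction s using Finset.induction_on with
  | empty => simp
  | insert a s ha ih => rw [sum_insert ha, sum_insert ha, EReal.coe_add, ih]

lemma signMean_coe {ι : Type*} [Fintype ι] [DecidableEq ι] (F : (ι → ℤˣ) → ℝ) :
    signMean (fun σ => (F σ : EReal)) = ((𝔼 σ, F σ : ℝ) : EReal) := by
  rw [signMean, Fintype.expect_eq_sum_div_card, Fintype.card_fun, Fintype.card_units_int,
    EReal.coe_div, coe_sum]
  norm_num

lemma signMean_mono {ι : Type*} [Fintype ι] [DecidableEq ι] {F G : (ι → ℤˣ) → EReal}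
    (h : ∀ σ, F σ ≤ G σ) : signMean F ≤ signMean G :=
  EReal.div_le_div_right_of_nonneg (by exact_mod_cast (by positivity))
    (sum_le_sum fun σ _ => h σ)

lemma sum_ne_bot {ι : Type*} (s : Finset ι) {F : ι → EReal} (hF : ∀ i ∈ s, F i ≠ ⊥) :
    ∑ i ∈ s, F i ≠ ⊥ := by
  classical
  induction s using Finset.induction_on with
  | empty => simp
  | insert a s ha ih =>
    rw [sum_insert ha, EReal.add_ne_bot_iff]
    exact ⟨hF a (by simp), ih fun i hi => hF i (by simp [hi])⟩

lemma ne_top_of_signMean_ne_top {ι : Type*} [Fintype ι] [DecidableEq ι]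
    {F : (ι → ℤˣ) → EReal} (hF : ∀ σ, F σ ≠ ⊥) (h : signMean F ≠ ⊤) (σ : ι → ℤˣ) :
    F σ ≠ ⊤ := by
  intro hσ
  apply h
  rw [signMean, ← Finset.add_sum_erase _ _ (mem_univ σ), hσ,
    EReal.top_add_of_ne_bot (sum_ne_bot _ fun i _ => hF i)]
  exact EReal.top_div_of_pos_ne_top (by exact_mod_cast (by positivity)) (EReal.coe_ne_top _)

lemma iSup_mem_eq_coe {α : Type*} {H : Set α} (hH : H.Nonempty) {u : α → ℝ}
    (hu : BddAbove (Set.range fun f : H => u f)) :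
    ⨆ f ∈ H, (u f : EReal) = ((⨆ f : H, u f : ℝ) : EReal) := by
  have := hH.to_subtype
  rw [iSup_subtype']
  refine le_antisymm (iSup_le fun f => ?_) ?_
  · exact_mod_cast le_ciSup hu f
  · by_cases htop : (⨆ f : H, (u f : EReal)) = ⊤
    · rw [htop]; exact le_top
    have hbot : (⨆ f : H, (u f : EReal)) ≠ ⊥ := by
      intro hb
      have := le_iSup (fun f : H => (u f : EReal)) (Classical.arbitrary H)
      rw [hb] at this
      exact EReal.coe_ne_bot _ (le_bot_iff.1 this)
    rw [← EReal.coe_toReal htop hbot, EReal.coe_le_coe_iff]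
    refine ciSup_le fun f => ?_
    rw [← EReal.coe_le_coe_iff, EReal.coe_toReal htop hbot]
    exact le_iSup (fun f : H => (u f : EReal)) f

lemma iSup_mem_coe_ne_bot {α : Type*} {H : Set α} (hH : H.Nonempty) (u : α → ℝ) :
    ⨆ f ∈ H, (u f : EReal) ≠ ⊥ := by
  obtain ⟨f, hf⟩ := hH
  intro hb
  have := le_iSup₂ (f := fun f (_ : f ∈ H) => (u f : EReal)) f hf
  rw [hb] at this
  exact EReal.coe_ne_bot _ (le_bot_iff.1 this)

lemma empRademacher_nonneg {X : Type*} {d n : ℕ} {H : Set (X → Vec d)} (hH : H.Nonempty)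
    (x : Fin n → X) : 0 ≤ empRademacher H x := by
  obtain ⟨f, hf⟩ := hH
  have h0 : 𝔼 σ : Fin n × Fin d → ℤˣ,
      1 / (n : ℝ) * ∑ i, ∑ j, ((σ (i, j) : ℤ) : ℝ) * f (x i) j = 0 := by
    have h := expect_signSum fun p : Fin n × Fin d => f (x p.1) p.2
    simp only [signSum, Fintype.sum_prod_type] at h
    rw [← mul_expect, h, mul_zero]
  have h1 := signMean_coe fun σ : Fin n × Fin d → ℤˣ =>
      1 / (n : ℝ) * ∑ i, ∑ j, ((σ (i, j) : ℤ) : ℝ) * f (x i) j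
  rw [h0, EReal.coe_zero] at h1
  rw [← h1]
  exact signMean_mono fun σ => le_iSup₂ (f := fun (g : X → Vec d) (_ : g ∈ H) =>
    ((1 / (n : ℝ) * ∑ i, ∑ j, ((σ (i, j) : ℤ) : ℝ) * g (x i) j : ℝ) : EReal)) f hf

variable {X : Type*} {d n : ℕ} {S : Set (Vec d)} {w : Vec d → Vec d} {μ γ : ℝ}

lemma IsOracle.isBdd_marginLoss (hw : IsOracle S w) (hγ : 0 < γ) (H : Set (X → Vec d)) (x : X)
    (c : Vec d) : IsBdd fun f : H => marginLoss S w γ (f.1 x) c :=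
  ⟨gap S c, fun f => by
    rw [abs_of_nonneg (hw.marginLoss_nonneg hγ _ _)]
    exact hw.marginLoss_le_gap hγ _ _⟩

lemma IsOracle.iSup_signed_marginLoss (hw : IsOracle S w) (hγ : 0 < γ) {H : Set (X → Vec d)}
    (hH : H.Nonempty) (z : Fin n → X × Vec d) (σ : Fin n → ℤˣ) (r : ℝ) :
    ⨆ f ∈ H, ((r * ∑ i, ((σ i : ℤ) : ℝ) * marginLoss S w γ (f (z i).1) (z i).2 : ℝ) : EReal)
      = ((⨆ f : H, r * signSum (fun i => marginLoss S w γ (f.1 (z i).1) (z i).2) σ : ℝ)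
          : EReal) :=
  iSup_mem_eq_coe (H := H)
    (u := fun f => r * signSum (fun i => marginLoss S w γ (f (z i).1) (z i).2) σ) hH
    ((IsBdd.signSum (fun i => hw.isBdd_marginLoss hγ H (z i).1 (z i).2) σ).const_mul r).bddAbove

lemma IsOracle.empMarginRademacher_eq (hw : IsOracle S w) (hγ : 0 < γ) {H : Set (X → Vec d)}
    (hH : H.Nonempty) (z : Fin n → X × Vec d) :
    empMarginRademacher S w γ H z = ((𝔼 σ, ⨆ f : H, 1 / (n : ℝ) *
      signSum (fun i => marginLoss S w γ (f.1 (z i).1) (z i).2) σ : ℝ) : EReal) := by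
  rw [empMarginRademacher, ← signMean_coe]
  congr 1
  funext σ
  exact hw.iSup_signed_marginLoss hγ hH z σ _

/-- Real suprema in the contraction step are meaningful only for bounded families. A finite average
forces each signed supremum to be finite, and for each f some sign pattern turns the signed sum into
the sum of absolute values. -/
lemma isBdd_of_empRademacher_ne_top (hn : 0 < n) {H : Set (X → Vec d)} (hH : H.Nonempty)
    {x : Fin n → X} (h : empRademacher H x ≠ ⊤) (i : Fin n) (j : Fin d) :
    IsBdd fun f : H => f.1 (x i) j := by
  have hn' : (0 : ℝ) < n := by exact_mod_cast hn
  have hbot := fun σ : Fin n × Fin d → ℤˣ => iSup_mem_coe_ne_bot hH fun f : X → Vec d =>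
    1 / (n : ℝ) * ∑ i, ∑ j, ((σ (i, j) : ℤ) : ℝ) * f (x i) j
  have htop := ne_top_of_signMean_ne_top hbot h
  have hle : ∀ σ : Fin n × Fin d → ℤˣ, ∃ M : ℝ, ∀ f ∈ H,
      1 / (n : ℝ) * ∑ i, ∑ j, ((σ (i, j) : ℤ) : ℝ) * f (x i) j ≤ M := by
    intro σ
    refine ⟨(⨆ f ∈ H, ((1 / (n : ℝ) * ∑ i, ∑ j, ((σ (i, j) : ℤ) : ℝ) * f (x i) j : ℝ) :
      EReal)).toReal, fun f hf => ?_⟩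
    rw [← EReal.coe_le_coe_iff, EReal.coe_toReal (htop σ) (hbot σ)]
    exact le_iSup₂ (f := fun (f : X → Vec d) (_ : f ∈ H) =>
      ((1 / (n : ℝ) * ∑ i, ∑ j, ((σ (i, j) : ℤ) : ℝ) * f (x i) j : ℝ) : EReal)) f hf
  choose M hM using hle
  refine ⟨n * ∑ σ, |M σ|, fun f => ?_⟩
  let τ : Fin n × Fin d → ℤˣ := fun p => if 0 ≤ f.1 (x p.1) p.2 then 1 else -1
  have hτ : ∀ p : Fin n × Fin d, ((τ p : ℤ) : ℝ) * f.1 (x p.1) p.2 = |f.1 (x p.1) p.2| := by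
    intro p
    simp only [τ]
    split_ifs with h0
    · simp [abs_of_nonneg h0]
    · simp [abs_of_neg (not_le.1 h0)]
  have h1 := hM τ f.1 f.2
  have h2 : ∑ i, ∑ j, ((τ (i, j) : ℤ) : ℝ) * f.1 (x i) j
      = ∑ p : Fin n × Fin d, |f.1 (x p.1) p.2| := by
    rw [Fintype.sum_prod_type]
    exact sum_congr rfl fun i _ => sum_congr rfl fun j _ => hτ (i, j)
  have h3 : |f.1 (x i) j| ≤ ∑ p : Fin n × Fin d, |f.1 (x p.1) p.2| :=
    single_le_sum (f := fun p : Fin n × Fin d => |f.1 (x p.1) p.2|)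
      (fun p _ => abs_nonneg _) (mem_univ (i, j))
  have h4 : M τ ≤ ∑ σ, |M σ| :=
    (le_abs_self _).trans (single_le_sum (f := fun σ => |M σ|) (fun p _ => abs_nonneg _)
      (mem_univ τ))
  rw [h2, one_div, inv_mul_le_iff₀ hn'] at h1
  exact h3.trans (h1.trans (by gcongr))

lemma IsStronglyConvexSet.empMarginRademacher_le (hS : IsStronglyConvexSet μ S) (hμ : 0 < μ)
    (hw : IsOracle S w) (hγ : 0 < γ) (hn : 0 < n) {H : Set (X → Vec d)} (hH : H.Nonempty)
    {z : Fin n → X × Vec d} {R : ℝ} (hR : ∀ i, ‖(z i).2‖ ≤ R) :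
    empMarginRademacher S w γ H z ≤
      ((5 * √2 * R / (γ * μ) : ℝ) : EReal) * empRademacher H (fun i => (z i).1) := by
  have := hH.to_subtype
  have hn' : (0 : ℝ) < n := by exact_mod_cast hn
  have hR0 : 0 ≤ R := (norm_nonneg _).trans (hR ⟨0, hn⟩)
  -- For R = 0 the complexity of H may be infinite and the right side is then 0 · ∞ = 0, so the
  -- losses themselves must be seen to vanish.
  rcases hR0.eq_or_lt with rfl | hRpos
  · have hz : ∀ i, (z i).2 = 0 := fun i => norm_le_zero_iff.1 (hR i)
    rw [hw.empMarginRademacher_eq hγ hH]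
    have h0 : ∀ p, marginLoss S w γ p 0 = 0 := by
      intro p; simp [marginLoss_eq hγ, spoLoss, hw.gap_eq]
    simp [hz, h0, signSum]
  by_cases htop : empRademacher H (fun i => (z i).1) = ⊤
  · rw [htop, EReal.coe_mul_top_of_pos (by positivity)]
    exact le_top
  have hbdd := isBdd_of_empRademacher_ne_top hn hH htop
  have hr : empRademacher H (fun i => (z i).1) =
      ((𝔼 σ : Fin n × Fin d → ℤˣ, ⨆ f : H, 1 / (n : ℝ) *
        ∑ i, ∑ j, ((σ (i, j) : ℤ) : ℝ) * f.1 (z i).1 j : ℝ) : EReal) := by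
    rw [empRademacher, ← signMean_coe]
    congr 1
    funext σ
    exact iSup_mem_eq_coe (H := H)
      (u := fun f => 1 / (n : ℝ) * ∑ i, ∑ j, ((σ (i, j) : ℤ) : ℝ) * f (z i).1 j) hH
      ((IsBdd.sum fun i => IsBdd.sum fun j => (hbdd i j).const_mul _).const_mul _).bddAbove
  have hnonneg := empRademacher_nonneg hH fun i => (z i).1
  rw [hr] at hnonneg ⊢
  rw [hw.empMarginRademacher_eq hγ hH, ← EReal.coe_mul, EReal.coe_le_coe_iff]
  replace hnonneg := EReal.coe_nonneg.1 hnonneg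
  set L : ℝ := 3 * R / (γ * μ) with hL
  have hL0 : 0 ≤ L := by positivity
  have hcontr := expect_iSup_signSum_le (ι := H) (A := fun _ => 0)
    (ψ := fun i f => 1 / (n : ℝ) * marginLoss S w γ (f.1 (z i).1) (z i).2)
    (φ := fun i f => (L / n) • f.1 (z i).1)
    ⟨0, by simp⟩ (fun i => (hw.isBdd_marginLoss hγ H _ _).const_mul _)
    (fun i j => (hbdd i j).const_mul _) (by
      intro i f g
      rw [← mul_sub, abs_mul, ← smul_sub, norm_smul, abs_of_nonneg (by positivity),
        Real.norm_of_nonneg (by positivity), div_eq_inv_mul L, one_div, mul_assoc]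
      gcongr
      refine (hS.marginLoss_lipschitz hμ hw hγ _ _ _).trans ?_
      rw [hL]
      gcongr
      exact hR i)
  calc 𝔼 σ, ⨆ f : H, 1 / (n : ℝ) *
        signSum (fun i => marginLoss S w γ (f.1 (z i).1) (z i).2) σ
      = 𝔼 σ, ⨆ f : H, (0 + signSum (fun i => 1 / (n : ℝ) *
          marginLoss S w γ (f.1 (z i).1) (z i).2) σ) := by
        refine expect_congr rfl fun σ _ => iSup_congr fun f => ?_
        rw [zero_add, ← signSum_smul]
        rfl
    _ ≤ _ := hcontr
    _ = 𝔼 σ : Fin n → Fin d → ℤˣ, 16 / 9 * L * ⨆ f : H, 1 / (n : ℝ) *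
          ∑ i, ∑ j, ((σ i j : ℤ) : ℝ) * f.1 (z i).1 j := by
        refine expect_congr rfl fun σ _ => ?_
        rw [Real.mul_iSup_of_nonneg (by positivity)]
        refine iSup_congr fun f => ?_
        rw [zero_add, ← mul_sum, mul_assoc, ← mul_assoc L, mul_one_div, mul_sum univ _ (L / n)]
        congr 1
        exact sum_congr rfl fun i _ => signSum_smul _ _ _
    _ = 16 / 9 * L * 𝔼 σ : Fin n × Fin d → ℤˣ, ⨆ f : H, 1 / (n : ℝ) *
          ∑ i, ∑ j, ((σ (i, j) : ℤ) : ℝ) * f.1 (z i).1 j := by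
        rw [← mul_expect]
        congr 1
        exact (Fintype.expect_equiv (Equiv.curry _ _ _) _ _ fun _ => rfl).symm
    _ ≤ _ := by
        gcongr
        -- The final comparison is 16/9 · 3 = 16/3 ≤ 7 = 5 · 1.4.
        have h2 : (1.4 : ℝ) ≤ √2 := Real.le_sqrt_of_sq_le (by norm_num)
        rw [hL, mul_div_assoc', div_le_div_iff_of_pos_right (by positivity)]
        nlinarith

end EmpiricalComplexity

/-! ### Lower integrals and McDiarmid's inequality -/

section BoundedDifferences

variable {Ω : Type*} [MeasurableSpace Ω] {D : Measure Ω}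

/-- The lower integral of a nonnegative real function; unlike the Bochner integral it is monotone
also on functions that are not measurable. -/
noncomputable def lowerMean (D : Measure Ω) (u : Ω → ℝ) : ℝ :=
  (∫⁻ x, ENNReal.ofReal (u x) ∂D).toReal

lemma lowerMean_nonneg (u : Ω → ℝ) : 0 ≤ lowerMean D u := ENNReal.toReal_nonneg

lemma lowerMean_eq_integral {u : Ω → ℝ} (hu : AEMeasurable u D) (h0 : ∀ x, 0 ≤ u x) :
    lowerMean D u = ∫ x, u x ∂D :=
  (integral_eq_lintegral_of_nonneg_ae (Filter.Eventually.of_forall h0)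
    hu.aestronglyMeasurable).symm

lemma integrable_of_bounded [IsFiniteMeasure D] {u : Ω → ℝ} {M : ℝ} (hu : AEMeasurable u D)
    (hM : ∀ x, |u x| ≤ M) : Integrable u D :=
  Integrable.of_bound hu.aestronglyMeasurable M (Filter.Eventually.of_forall hM)

lemma integrable_exp_mul_sub [IsFiniteMeasure D] {u : Ω → ℝ} {M : ℝ} (hu : AEMeasurable u D)
    (h0 : ∀ x, 0 ≤ u x) (hM : ∀ x, u x ≤ M) (s m : ℝ) :
    Integrable (fun x => Real.exp (s * (u x - m))) D := by
  have hexp : AEMeasurable (fun x => Real.exp (s * (u x - m))) D := by fun_prop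
  refine integrable_of_bounded (M := Real.exp (|s| * (M + |m|))) hexp fun x => ?_
  rw [abs_of_pos (Real.exp_pos _), Real.exp_le_exp]
  refine (le_abs_self _).trans ?_
  rw [abs_mul]
  gcongr
  refine (abs_sub _ _).trans ?_
  gcongr
  rw [abs_of_nonneg (h0 _)]
  exact hM _

lemma le_of_update_le {α : Type*} {n : ℕ} {g : (Fin n → α) → ℝ}
    (hc : ∀ z i x, g (Function.update z i x) ≤ g z) (z z' : Fin n → α) : g z ≤ g z' := by
  induction n with
  | zero => exact (congrArg g (Subsingleton.elim _ _)).le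
  | succ n ih =>
    have h1 := ih (g := fun y => g (Fin.cons (z 0) y)) (fun y i x => by
      simp only [Fin.cons_update]; exact hc _ _ _) (Fin.tail z) (Fin.tail z')
    have h2 := hc z' 0 (z 0)
    rw [← Fin.cons_self_tail z', Fin.update_cons_zero] at h2
    simp only [Fin.cons_self_tail] at h1 h2
    exact h1.trans h2

variable [IsProbabilityMeasure D]

lemma lintegral_ofReal_le {u : Ω → ℝ} {M : ℝ} (hu : ∀ x, u x ≤ M) :
    ∫⁻ x, ENNReal.ofReal (u x) ∂D ≤ ENNReal.ofReal M :=
  (lintegral_mono fun x => ENNReal.ofReal_le_ofReal (hu x)).trans (by simp)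

lemma lowerMean_le {u : Ω → ℝ} {M : ℝ} (hM : 0 ≤ M) (hu : ∀ x, u x ≤ M) :
    lowerMean D u ≤ M :=
  ENNReal.toReal_le_of_le_ofReal hM (lintegral_ofReal_le hu)

lemma lowerMean_le_add {u v : Ω → ℝ} {M c : ℝ} (hv : ∀ x, v x ≤ M) (hc : 0 ≤ c)
    (huv : ∀ x, u x ≤ v x + c) : lowerMean D u ≤ lowerMean D v + c := by
  have hfin : ∫⁻ x, ENNReal.ofReal (v x) ∂D ≠ ⊤ :=
    ((lintegral_ofReal_le hv).trans_lt ENNReal.ofReal_lt_top).ne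
  refine ENNReal.toReal_le_of_le_ofReal (add_nonneg (lowerMean_nonneg v) hc) ?_
  rw [ENNReal.ofReal_add (lowerMean_nonneg v) hc, lowerMean, ENNReal.ofReal_toReal hfin]
  calc ∫⁻ x, ENNReal.ofReal (u x) ∂D
      ≤ ∫⁻ x, ENNReal.ofReal (v x) + ENNReal.ofReal c ∂D :=
        lintegral_mono fun x => (ENNReal.ofReal_le_ofReal (huv x)).trans ENNReal.ofReal_add_le
    _ = _ := by rw [lintegral_add_right _ measurable_const]; simp

/-- Hoeffding's lemma for a function with oscillation at most `c`. -/
lemma integral_exp_le_of_oscillation_le {u : Ω → ℝ} {c : ℝ} (hu : AEMeasurable u D)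
    (h0 : ∀ x, 0 ≤ u x) (hc : ∀ x y, u x ≤ u y + c) (s m : ℝ) :
    ∫ x, Real.exp (s * (u x - m)) ∂D
      ≤ Real.exp (s * (∫ x, u x ∂D - m)) * Real.exp (s ^ 2 * c ^ 2 / 8) := by
  have hne : Nonempty Ω := nonempty_of_isProbabilityMeasure D
  have hb : ∀ᵐ x ∂D, u x ∈ Set.Icc (⨅ y, u y) ((⨅ y, u y) + c) := by
    refine Filter.Eventually.of_forall fun x => ⟨ciInf_le ⟨0, ?_⟩ x, ?_⟩
    · rintro _ ⟨y, rfl⟩; exact h0 y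
    · rw [← sub_le_iff_le_add]
      exact le_ciInf fun y => by linarith [hc x y]
  have h := (ProbabilityTheory.hasSubgaussianMGF_of_mem_Icc hu hb).mgf_le s
  have e : ((((‖(⨅ y, u y) + c - ⨅ y, u y‖₊ / 2) ^ 2 : NNReal) : ℝ)) * s ^ 2 / 2
      = s ^ 2 * c ^ 2 / 8 := by
    rw [add_sub_cancel_left]
    push_cast
    rw [Real.norm_eq_abs, div_pow, sq_abs]
    ring
  rw [e, ProbabilityTheory.mgf] at h
  calc ∫ x, Real.exp (s * (u x - m)) ∂D
      = ∫ x, Real.exp (s * (∫ x, u x ∂D - m)) * Real.exp (s * (u x - ∫ x, u x ∂D)) ∂D := by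
        congr 1
        funext x
        rw [← Real.exp_add]
        congr 1
        ring
    _ = Real.exp (s * (∫ x, u x ∂D - m)) * ∫ x, Real.exp (s * (u x - ∫ x, u x ∂D)) ∂D :=
        integral_const_mul _ _
    _ ≤ _ := by gcongr

/-- The exponential moment bound behind McDiarmid's bounded differences inequality. -/
lemma integral_exp_le_of_boundedDifferences {n : ℕ} {g : (Fin n → Ω) → ℝ} {M c : ℝ}
    (hg : AEMeasurable g (Measure.pi fun _ => D)) (h0 : ∀ z, 0 ≤ g z) (hM : ∀ z, g z ≤ M)
    (hc0 : 0 ≤ c) (hc : ∀ z i x, g (Function.update z i x) ≤ g z + c) (s : ℝ) :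
    ∫ z, Real.exp (s * (g z - ∫ z, g z ∂(Measure.pi fun _ => D))) ∂(Measure.pi fun _ => D)
      ≤ Real.exp (n * (s ^ 2 * c ^ 2 / 8)) := by
  have hne : Nonempty Ω := nonempty_of_isProbabilityMeasure D
  have hM0 : 0 ≤ M := (h0 fun _ => hne.some).trans (hM _)
  induction n with
  | zero =>
    have : ∀ z, g z = g Fin.elim0 := fun z => congrArg g (Subsingleton.elim _ _)
    simp [this]
  | succ n ih =>
    set P : Measure (Fin n → Ω) := Measure.pi fun _ => D with hP
    set Q : Measure (Fin (n + 1) → Ω) := Measure.pi fun _ => D with hQ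
    have hmp : MeasurePreserving (MeasurableEquiv.piFinSuccAbove (fun _ => Ω) 0).symm
        (D.prod P) Q :=
      (measurePreserving_piFinSuccAbove (fun _ : Fin (n + 1) => D) 0).symm
    set G : Ω × (Fin n → Ω) → ℝ := fun p => g (Fin.cons p.1 p.2) with hG
    have hGe : ∀ p, g ((MeasurableEquiv.piFinSuccAbove (fun _ => Ω) 0).symm p) = G p := by
      intro p
      simp only [hG, MeasurableEquiv.piFinSuccAbove_symm_apply, Fin.insertNthEquiv_zero]
      rfl
    have hGm : AEMeasurable G (D.prod P) := by
      have := hg.comp_quasiMeasurePreserving hmp.quasiMeasurePreserving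
      exact this.congr (Filter.Eventually.of_forall hGe)
    -- The first coordinate is averaged out by a lower integral: the induction hypothesis requires
    -- bounded differences at every y, whereas the slice at y is measurable only for almost every y.
    set gb : (Fin n → Ω) → ℝ := fun y => lowerMean D fun x => G (x, y) with hgb
    have hslice : ∀ᵐ y ∂P, AEMeasurable (fun x => G (x, y)) D := by
      have h1 : AEMeasurable (fun p : (Fin n → Ω) × Ω => G p.swap) (P.prod D) := hGm.prod_swap
      filter_upwards [h1.aestronglyMeasurable.prodMk_left] with y hy
      exact hy.aemeasurable
    have hgbe : ∀ᵐ y ∂P, gb y = ∫ x, G (x, y) ∂D := by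
      filter_upwards [hslice] with y hy
      exact lowerMean_eq_integral hy fun x => h0 _
    have hgbm : AEMeasurable gb P :=
      (AEMeasurable.lintegral_prod_left' hGm.ennreal_ofReal).ennreal_toReal
    have hGint : Integrable G (D.prod P) :=
      integrable_of_bounded hGm fun p => abs_le.2 ⟨by linarith [h0 (Fin.cons p.1 p.2)], hM _⟩
    have hmean : ∫ z, g z ∂Q = ∫ y, gb y ∂P := by
      rw [← hmp.integral_comp', integral_congr_ae hgbe, ← integral_prod_symm _ hGint]
      exact integral_congr_ae (Filter.Eventually.of_forall hGe)
    set m := ∫ z, g z ∂Q with hm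
    have hexpint : Integrable (fun p => Real.exp (s * (G p - m))) (D.prod P) :=
      integrable_exp_mul_sub hGm (fun _ => h0 _) (fun _ => hM _) s m
    have hgbexpint : Integrable (fun y => Real.exp (s * (gb y - m))) P :=
      integrable_exp_mul_sub hgbm (fun _ => lowerMean_nonneg _)
        (fun _ => lowerMean_le hM0 fun _ => hM _) s m
    have hih := ih (g := gb) hgbm (fun y => lowerMean_nonneg _)
      (fun y => lowerMean_le hM0 fun x => hM _) (fun y i x => by
        refine lowerMean_le_add (fun _ => hM _) hc0 fun x' => ?_
        simp only [hG]
        rw [Fin.cons_update]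
        exact hc _ _ _)
    rw [← hmean] at hih
    calc ∫ z, Real.exp (s * (g z - m)) ∂Q
        = ∫ p, Real.exp (s * (G p - m)) ∂(D.prod P) := by
          rw [← hmp.integral_comp']
          exact integral_congr_ae (Filter.Eventually.of_forall fun p => by simp only [hGe])
      _ = ∫ y, ∫ x, Real.exp (s * (G (x, y) - m)) ∂D ∂P := integral_prod_symm _ hexpint
      _ ≤ ∫ y, Real.exp (s * (gb y - m)) * Real.exp (s ^ 2 * c ^ 2 / 8) ∂P := by
          refine integral_mono_ae hexpint.integral_prod_right (hgbexpint.mul_const _) ?_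
          filter_upwards [hslice, hgbe] with y hy hye
          rw [hye]
          refine integral_exp_le_of_oscillation_le hy (fun _ => h0 _) (fun x x' => ?_) s m
          have := hc (Fin.cons x' y) 0 x
          rwa [Fin.update_cons_zero] at this
      _ = (∫ y, Real.exp (s * (gb y - m)) ∂P) * Real.exp (s ^ 2 * c ^ 2 / 8) :=
          integral_mul_const _ _
      _ ≤ Real.exp (n * (s ^ 2 * c ^ 2 / 8)) * Real.exp (s ^ 2 * c ^ 2 / 8) := by gcongr
      _ = _ := by
          rw [← Real.exp_add]
          congr 1
          push_cast
          ring

/-- McDiarmid's bounded differences inequality. -/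
lemma measure_gt_le_of_boundedDifferences {n : ℕ} (hn : 0 < n) {g : (Fin n → Ω) → ℝ} {M B : ℝ}
    (hg : AEMeasurable g (Measure.pi fun _ => D)) (h0 : ∀ z, 0 ≤ g z) (hM : ∀ z, g z ≤ M)
    (hB : 0 ≤ B) (hc : ∀ z i x, g (Function.update z i x) ≤ g z + B / n)
    {δ : ℝ} (hδ : 0 < δ) (hδ1 : δ ≤ 1) :
    (Measure.pi fun _ => D) {z | ∫ z, g z ∂(Measure.pi fun _ => D)
      + B * √(Real.log (1 / δ) / (2 * n)) < g z} ≤ ENNReal.ofReal δ := by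
  have hn' : (0 : ℝ) < n := by exact_mod_cast hn
  set P : Measure (Fin n → Ω) := Measure.pi fun _ => D with hP
  set m := ∫ z, g z ∂P with hm
  -- The optimal s below divides by B; for B = 0 the function is constant.
  rcases hB.eq_or_lt with rfl | hB
  · have hconst : ∀ z z', g z = g z' := fun z z' =>
      le_antisymm (le_of_update_le (by simpa using hc) z z')
        (le_of_update_le (by simpa using hc) z' z)
    have hmz : ∀ z, m = g z := fun z => by
      rw [hm, integral_congr_ae (Filter.Eventually.of_forall fun z' => hconst z' z)]
      simp
    have : {z | m + 0 * √(Real.log (1 / δ) / (2 * n)) < g z} = ∅ := by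
      ext z
      simp [← hmz z]
    rw [this]
    simp
  set L := Real.log (1 / δ) with hL
  have hL0 : 0 ≤ L := Real.log_nonneg (by rw [le_div_iff₀ hδ]; linarith)
  set t := √(L / (2 * n)) with ht
  have ht2 : t ^ 2 * (2 * n) = L := by
    rw [ht, Real.sq_sqrt (by positivity)]; field_simp
  -- This s minimizes −s B t + s² B² / (8n), with minimum −2 n t² = −L.
  set s := 4 * n * t / B with hs
  have hexp := integral_exp_le_of_boundedDifferences hg h0 hM (c := B / n) (by positivity) hc s
  have hmarkov := ProbabilityTheory.measure_ge_le_exp_mul_mgf (X := fun z => g z - m) (μ := P)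
    (B * t) (t := s) (by positivity) (integrable_exp_mul_sub hg h0 hM s m)
  have hreal : P.real {z | B * t ≤ g z - m} ≤ δ := by
    refine hmarkov.trans ?_
    rw [ProbabilityTheory.mgf]
    calc Real.exp (-s * (B * t)) * ∫ z, Real.exp (s * (g z - m)) ∂P
        ≤ Real.exp (-s * (B * t)) * Real.exp (n * (s ^ 2 * (B / n) ^ 2 / 8)) := by gcongr
      _ = Real.exp (-L) := by
          rw [← Real.exp_add, ← ht2, hs]
          congr 1
          field_simp
          ring
      _ = δ := by rw [hL, one_div, Real.log_inv, neg_neg, Real.exp_log hδ]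
  calc P {z | m + B * t < g z} ≤ P {z | B * t ≤ g z - m} :=
        measure_mono fun z (hz : m + B * t < g z) => by
          simp only [Set.mem_ofPred_eq]; linarith
    _ = ENNReal.ofReal (P.real {z | B * t ≤ g z - m}) := by simp
    _ ≤ _ := ENNReal.ofReal_le_ofReal hreal

end BoundedDifferences

/-! ### Symmetrization and uniform deviation bounds -/

section Symmetrization

open Finset
open scoped BigOperators

variable {I Ω κ κ' : Type*} [Fintype κ] [Fintype κ'] {h : I → Ω → ℝ} {B : ℝ}

/-- The supremum of a signed sum over a family `h` of functions. -/
noncomputable def signSup (h : I → Ω → ℝ) (σ : κ → ℤˣ) (z : κ → Ω) : ℝ :=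
  ⨆ i, signSum (fun k => h i (z k)) σ

/-- The empirical Rademacher complexity of a family `h` of functions. -/
noncomputable def familyRademacher {n : ℕ} (h : I → Ω → ℝ) (z : Fin n → Ω) : ℝ :=
  1 / (n : ℝ) * 𝔼 σ, signSup h σ z

lemma signSup_comp_equiv (e : κ ≃ κ') (σ : κ → ℤˣ) (z : κ' → Ω) :
    signSup h σ (z ∘ e) = signSup h (σ ∘ e.symm) z := by
  refine iSup_congr fun i => ?_
  simp only [signSum, Function.comp_apply]
  exact Fintype.sum_equiv e _ _ fun k => by simp

lemma abs_signSum_le_of_mem (hh0 : ∀ i x, 0 ≤ h i x) (hhB : ∀ i x, h i x ≤ B) (σ : κ → ℤˣ)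
    (z : κ → Ω) (i : I) : |signSum (fun k => h i (z k)) σ| ≤ Fintype.card κ * B := by
  refine (abs_signSum_le _ _).trans ?_
  rw [← nsmul_eq_mul]
  exact sum_le_card_nsmul _ _ _ fun k _ => by rw [abs_of_nonneg (hh0 _ _)]; exact hhB _ _

lemma isBdd_signSum (hh0 : ∀ i x, 0 ≤ h i x) (hhB : ∀ i x, h i x ≤ B) (σ : κ → ℤˣ)
    (z : κ → Ω) : IsBdd fun i => signSum (fun k => h i (z k)) σ :=
  ⟨_, abs_signSum_le_of_mem hh0 hhB σ z⟩

lemma signSum_le_signSup (hh0 : ∀ i x, 0 ≤ h i x) (hhB : ∀ i x, h i x ≤ B) (σ : κ → ℤˣ)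
    (z : κ → Ω) (i : I) : signSum (fun k => h i (z k)) σ ≤ signSup h σ z :=
  le_ciSup (isBdd_signSum hh0 hhB σ z).bddAbove i

lemma signSum_update_le [DecidableEq κ] (hh0 : ∀ i x, 0 ≤ h i x) (hhB : ∀ i x, h i x ≤ B)
    (σ : κ → ℤˣ) (z : κ → Ω) (k : κ) (x : Ω) (i : I) :
    signSum (fun j => h i (Function.update z k x j)) σ ≤ signSum (fun j => h i (z j)) σ + B := by
  simp only [signSum]
  rw [← add_sum_erase _ _ (mem_univ k), ← add_sum_erase univ
    (fun j => ((σ j : ℤ) : ℝ) * h i (z j)) (mem_univ k), Function.update_self]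
  have e : ∑ j ∈ univ.erase k, ((σ j : ℤ) : ℝ) * h i (Function.update z k x j)
      = ∑ j ∈ univ.erase k, ((σ j : ℤ) : ℝ) * h i (z j) :=
    sum_congr rfl fun j hj => by rw [Function.update_of_ne (ne_of_mem_erase hj)]
  rw [e]
  have h1 := hh0 i x
  have h2 := hhB i x
  have h3 := hh0 i (z k)
  have h4 := hhB i (z k)
  rcases Int.units_eq_one_or (σ k) with hs | hs <;> rw [hs] <;> push_cast <;> linarith

lemma measurePreserving_comp_equiv [MeasurableSpace Ω] (D : Measure Ω) [SigmaFinite D]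
    (e : κ ≃ κ') : MeasurePreserving (fun z : κ' → Ω => z ∘ e) (Measure.pi fun _ => D)
      (Measure.pi fun _ => D) := by
  have h := measurePreserving_piCongrLeft (fun _ : κ => D) e.symm
  convert h using 1
  funext z
  funext k
  have := Equiv.piCongrLeft_apply_apply (fun _ : κ => Ω) e.symm z (e k)
  simp only [Equiv.symm_apply_apply] at this
  simp [MeasurableEquiv.coe_piCongrLeft, this]

lemma integral_comp_measurePreserving {α β : Type*} [MeasurableSpace α] [MeasurableSpace β]
    {P : Measure α} {Q : Measure β} {φ : α → β} (hφ : MeasurePreserving φ P Q) {F : β → ℝ}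
    (hF : AEMeasurable F Q) : ∫ x, F (φ x) ∂P = ∫ y, F y ∂Q := by
  rw [← hφ.map_eq] at hF ⊢
  exact (integral_map hφ.measurable.aemeasurable hF.aestronglyMeasurable).symm

/-- Reindexing extends the hypothesis from `Fin m` to any finite index type, in particular to `Fin n
⊕ Fin n`, which indexes a sample together with its ghost. -/
lemma aemeasurable_signSup [MeasurableSpace Ω] {D : Measure Ω} [IsProbabilityMeasure D]
    (hm : ∀ (m : ℕ) (σ : Fin m → ℤˣ), AEMeasurable (signSup h σ) (Measure.pi fun _ => D))
    (σ : κ → ℤˣ) : AEMeasurable (signSup h σ) (Measure.pi fun _ => D) := by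
  have e := Fintype.equivFin κ
  have h1 := (hm _ (σ ∘ e.symm)).comp_quasiMeasurePreserving
    (measurePreserving_comp_equiv D e.symm).quasiMeasurePreserving
  refine h1.congr (Filter.Eventually.of_forall fun z => ?_)
  simp only [Function.comp_def (signSup h (σ ∘ e.symm))]
  rw [← signSup_comp_equiv e]
  congr 1
  funext k
  simp

lemma aemeasurable_familyRademacher [MeasurableSpace Ω] {D : Measure Ω} {n : ℕ}
    (hm : ∀ (m : ℕ) (σ : Fin m → ℤˣ), AEMeasurable (signSup h σ) (Measure.pi fun _ => D)) :
    AEMeasurable (familyRademacher (n := n) h) (Measure.pi fun _ => D) := by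
  unfold familyRademacher
  simp only [Fintype.expect_eq_sum_div_card]
  exact (((aemeasurable_fun_sum _ fun σ _ => hm n σ).div_const _).const_mul _)

lemma aemeasurable_ghost [MeasurableSpace Ω] {D : Measure Ω}
    [IsProbabilityMeasure D] {n : ℕ}
    (hm : ∀ (m : ℕ) (σ : Fin m → ℤˣ), AEMeasurable (signSup h σ) (Measure.pi fun _ => D)) :
    AEMeasurable (fun p : (Fin n → Ω) × (Fin n → Ω) =>
        signSup h (Sum.elim 1 (-1)) (Sum.elim p.1 p.2))
      ((Measure.pi fun _ => D).prod (Measure.pi fun _ => D)) :=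
  (aemeasurable_signSup hm _).comp_quasiMeasurePreserving
    (measurePreserving_sumPiEquivProdPi_symm
      (fun _ : Fin n ⊕ Fin n => D)).quasiMeasurePreserving

/-- The permutation of two copies of `α` that exchanges the two copies of those `k` for which
`τ k = -1`. -/
def swapPerm {α : Type*} (τ : α → ℤˣ) : Equiv.Perm (α ⊕ α) :=
  Function.Involutive.toPerm
    (Sum.elim (fun k => if τ k = 1 then Sum.inl k else Sum.inr k)
      fun k => if τ k = 1 then Sum.inr k else Sum.inl k) (by
    rintro (k | k) <;> by_cases hk : τ k = 1 <;> simp [hk])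

lemma sumElim_comp_swapPerm_symm {α : Type*} (τ : α → ℤˣ) :
    (Sum.elim 1 (-1) : α ⊕ α → ℤˣ) ∘ (swapPerm τ).symm = Sum.elim τ (-τ) := by
  have hsymm : ⇑(swapPerm τ).symm = Sum.elim (fun k => if τ k = 1 then Sum.inl k else Sum.inr k)
      fun k => if τ k = 1 then Sum.inr k else Sum.inl k := rfl
  funext p
  rw [hsymm]
  rcases p with k | k <;> rcases Int.units_eq_one_or (τ k) with hk | hk <;> simp [hk]

/-- The expected deviation `sup_i ∑_k (h_i (y_k) - h_i (z_k))` of a sample `z` from an independent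
ghost sample `y`, shifted by `n B` to make it nonnegative. -/
noncomputable def ghostDeviation [MeasurableSpace Ω] {n : ℕ} (D : Measure Ω) (h : I → Ω → ℝ) (B : ℝ)
    (z : Fin n → Ω) : ℝ :=
  lowerMean (Measure.pi fun _ => D)
    fun y => signSup (κ := Fin n ⊕ Fin n) h (Sum.elim 1 (-1)) (Sum.elim y z) + 2 * n * B

lemma aemeasurable_ghostDeviation [MeasurableSpace Ω] {D : Measure Ω}
    [IsProbabilityMeasure D] {n : ℕ}
    (hm : ∀ (m : ℕ) (σ : Fin m → ℤˣ), AEMeasurable (signSup h σ) (Measure.pi fun _ => D)) :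
    AEMeasurable (ghostDeviation (n := n) D h B) (Measure.pi fun _ => D) :=
  (AEMeasurable.lintegral_prod_left'
    ((aemeasurable_ghost hm).add_const _).ennreal_ofReal).ennreal_toReal

variable [Nonempty I]

lemma signSup_update_le [DecidableEq κ] (hh0 : ∀ i x, 0 ≤ h i x) (hhB : ∀ i x, h i x ≤ B)
    (σ : κ → ℤˣ) (z : κ → Ω) (k : κ) (x : Ω) :
    signSup h σ (Function.update z k x) ≤ signSup h σ z + B :=
  ciSup_le fun i => (signSum_update_le hh0 hhB σ z k x i).trans
    (by gcongr; exact signSum_le_signSup hh0 hhB σ z i)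

lemma abs_signSup_le (hh0 : ∀ i x, 0 ≤ h i x) (hhB : ∀ i x, h i x ≤ B) (σ : κ → ℤˣ)
    (z : κ → Ω) : |signSup h σ z| ≤ Fintype.card κ * B := by
  refine abs_le.2 ⟨?_, ciSup_le fun i => (abs_le.1 (abs_signSum_le_of_mem hh0 hhB σ z i)).2⟩
  exact (abs_le.1 (abs_signSum_le_of_mem hh0 hhB σ z (Classical.arbitrary I))).1.trans
    (signSum_le_signSup hh0 hhB σ z _)

lemma signSup_sumElim_le (hh0 : ∀ i x, 0 ≤ h i x) (hhB : ∀ i x, h i x ≤ B) (σ : κ → ℤˣ)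
    (τ : κ' → ℤˣ) (y : κ → Ω) (z : κ' → Ω) :
    signSup h (Sum.elim σ τ) (Sum.elim y z) ≤ signSup h σ y + signSup h τ z := by
  refine ciSup_le fun i => ?_
  simp only [signSum, Fintype.sum_sum_type, Sum.elim_inl, Sum.elim_inr]
  exact add_le_add (signSum_le_signSup hh0 hhB σ y i) (signSum_le_signSup hh0 hhB τ z i)

lemma familyRademacher_nonneg (hh0 : ∀ i x, 0 ≤ h i x) (hhB : ∀ i x, h i x ≤ B) {n : ℕ}
    (z : Fin n → Ω) : 0 ≤ familyRademacher h z := by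
  refine mul_nonneg (by positivity) ?_
  rw [← expect_signSum fun k => h (Classical.arbitrary I) (z k)]
  exact expect_le_expect fun σ _ => signSum_le_signSup hh0 hhB σ z _

lemma familyRademacher_le (hh0 : ∀ i x, 0 ≤ h i x) (hhB : ∀ i x, h i x ≤ B) {n : ℕ}
    (hn : 0 < n) (z : Fin n → Ω) : familyRademacher h z ≤ B := by
  have hn' : (0 : ℝ) < n := by exact_mod_cast hn
  rw [familyRademacher, one_div, inv_mul_le_iff₀ hn']
  refine expect_le univ_nonempty fun σ _ => ?_
  simpa using (abs_le.1 (abs_signSup_le hh0 hhB σ z)).2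

lemma familyRademacher_update_le (hh0 : ∀ i x, 0 ≤ h i x) (hhB : ∀ i x, h i x ≤ B) {n : ℕ}
    (z : Fin n → Ω) (k : Fin n) (x : Ω) :
    familyRademacher h (Function.update z k x) ≤ familyRademacher h z + B / n := by
  have h1 : 𝔼 σ, signSup h σ (Function.update z k x) ≤ 𝔼 σ : Fin n → ℤˣ, (signSup h σ z + B) :=
    expect_le_expect fun σ _ => signSup_update_le hh0 hhB σ z k x
  rw [expect_add_distrib, expect_const univ_nonempty] at h1
  rw [familyRademacher, familyRademacher, div_eq_inv_mul B, ← one_div, ← mul_add]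
  gcongr

lemma ghost_nonneg_and_le {n : ℕ} (hh0 : ∀ i x, 0 ≤ h i x) (hhB : ∀ i x, h i x ≤ B)
    (y z : Fin n → Ω) :
    0 ≤ signSup h (Sum.elim 1 (-1)) (Sum.elim y z) + 2 * n * B ∧
      signSup h (Sum.elim 1 (-1)) (Sum.elim y z) + 2 * n * B ≤ 4 * n * B := by
  have h1 := abs_le.1 (abs_signSup_le hh0 hhB (Sum.elim 1 (-1)) (Sum.elim y z))
  rw [Fintype.card_sum, Fintype.card_fin] at h1
  push_cast at h1
  constructor <;> linarith

variable [MeasurableSpace Ω] {D : Measure Ω} [IsProbabilityMeasure D]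

lemma integral_expect_signSup {n : ℕ} (hh0 : ∀ i x, 0 ≤ h i x) (hhB : ∀ i x, h i x ≤ B)
    (hm : ∀ (m : ℕ) (σ : Fin m → ℤˣ), AEMeasurable (signSup h σ) (Measure.pi fun _ => D)) :
    ∫ z : Fin n → Ω, 𝔼 σ, signSup h σ z ∂(Measure.pi fun _ => D)
      = 𝔼 σ, ∫ z : Fin n → Ω, signSup h σ z ∂(Measure.pi fun _ => D) := by
  simp only [Fintype.expect_eq_sum_div_card]
  rw [integral_div, integral_finsetSum]
  exact fun σ _ => integrable_of_bounded (hm n σ) (abs_signSup_le hh0 hhB σ)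

/-- Symmetrization with a ghost sample. -/
lemma integral_signSup_sumElim_le {n : ℕ} (hh0 : ∀ i x, 0 ≤ h i x) (hhB : ∀ i x, h i x ≤ B)
    (hm : ∀ (m : ℕ) (σ : Fin m → ℤˣ), AEMeasurable (signSup h σ) (Measure.pi fun _ => D)) :
    ∫ p : (Fin n → Ω) × (Fin n → Ω), signSup h (Sum.elim 1 (-1)) (Sum.elim p.1 p.2)
        ∂((Measure.pi fun _ => D).prod (Measure.pi fun _ => D))
      ≤ 2 * ∫ z : Fin n → Ω, 𝔼 σ, signSup h σ z ∂(Measure.pi fun _ => D) := by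
  set P : Measure (Fin n → Ω) := Measure.pi fun _ => D with hP
  have hsum : MeasurePreserving (fun p : (Fin n → Ω) × (Fin n → Ω) => Sum.elim p.1 p.2)
      (P.prod P) (Measure.pi fun _ => D) :=
    measurePreserving_sumPiEquivProdPi_symm (fun _ : Fin n ⊕ Fin n => D)
  have hint : ∀ σ : Fin n → ℤˣ, Integrable (signSup h σ) P := fun σ =>
    integrable_of_bounded (hm n σ) (abs_signSup_le hh0 hhB σ)
  -- Exchanging the k-th points of the two samples where τ k = −1 preserves their joint law and
  -- turns the signs (1, −1) into (τ, −τ). The supremum then splits; averaging over τ, both parts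
  -- have the same mean because −τ is distributed like τ.
  have hone : ∀ τ : Fin n → ℤˣ,
      ∫ p : (Fin n → Ω) × (Fin n → Ω), signSup h (Sum.elim 1 (-1)) (Sum.elim p.1 p.2) ∂(P.prod P)
        ≤ ∫ z, signSup h τ z ∂P + ∫ z, signSup h (-τ) z ∂P := by
    intro τ
    have hae := aemeasurable_signSup (D := D) hm (Sum.elim 1 (-1) : Fin n ⊕ Fin n → ℤˣ)
    have haeτ := aemeasurable_signSup (D := D) hm (Sum.elim τ (-τ) : Fin n ⊕ Fin n → ℤˣ)
    have hintτ : Integrable (fun p : (Fin n → Ω) × (Fin n → Ω) =>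
        signSup h (Sum.elim τ (-τ)) (Sum.elim p.1 p.2)) (P.prod P) :=
      integrable_of_bounded (haeτ.comp_quasiMeasurePreserving hsum.quasiMeasurePreserving)
        fun _ => abs_signSup_le hh0 hhB _ _
    calc ∫ p : (Fin n → Ω) × (Fin n → Ω),
          signSup h (Sum.elim 1 (-1)) (Sum.elim p.1 p.2) ∂(P.prod P)
        = ∫ u, signSup h (Sum.elim 1 (-1) : Fin n ⊕ Fin n → ℤˣ) u ∂(Measure.pi fun _ => D) :=
          integral_comp_measurePreserving hsum hae
      _ = ∫ u, signSup h (Sum.elim 1 (-1) : Fin n ⊕ Fin n → ℤˣ) (u ∘ swapPerm τ)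
            ∂(Measure.pi fun _ => D) :=
          (integral_comp_measurePreserving (measurePreserving_comp_equiv D (swapPerm τ)) hae).symm
      _ = ∫ u, signSup h (Sum.elim τ (-τ) : Fin n ⊕ Fin n → ℤˣ) u ∂(Measure.pi fun _ => D) := by
          simp only [signSup_comp_equiv, sumElim_comp_swapPerm_symm]
      _ = ∫ p : (Fin n → Ω) × (Fin n → Ω),
          signSup h (Sum.elim τ (-τ)) (Sum.elim p.1 p.2) ∂(P.prod P) :=
          (integral_comp_measurePreserving hsum haeτ).symm
      _ ≤ ∫ p : (Fin n → Ω) × (Fin n → Ω), (signSup h τ p.1 + signSup h (-τ) p.2)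
            ∂(P.prod P) :=
          integral_mono hintτ (((hint τ).comp_fst P).add ((hint (-τ)).comp_snd P))
            fun p => signSup_sumElim_le hh0 hhB _ _ _ _
      _ = _ := by
          rw [integral_add ((hint τ).comp_fst P) ((hint (-τ)).comp_snd P), integral_fun_fst,
            integral_fun_snd]
          simp
  rw [integral_expect_signSup hh0 hhB hm]
  have h2 := expect_le_expect fun (τ : Fin n → ℤˣ) (_ : τ ∈ univ) => hone τ
  rw [expect_const univ_nonempty, expect_add_distrib,
    expect_neg_eq fun τ => ∫ z, signSup h τ z ∂P] at h2
  linarith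

lemma ghostDeviation_update_le {n : ℕ} (hh0 : ∀ i x, 0 ≤ h i x) (hhB : ∀ i x, h i x ≤ B)
    (hB : 0 ≤ B) (z : Fin n → Ω) (k : Fin n) (x : Ω) :
    ghostDeviation D h B (Function.update z k x) ≤ ghostDeviation D h B z + B := by
  refine lowerMean_le_add (fun y => (ghost_nonneg_and_le hh0 hhB y z).2) hB fun y => ?_
  have e : Sum.elim y (Function.update z k x) = Function.update (Sum.elim y z) (Sum.inr k) x :=
    Sum.update_elim_inr.symm
  rw [e]
  linarith [signSup_update_le hh0 hhB (Sum.elim 1 (-1)) (Sum.elim y z) (Sum.inr k) x]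

/-- Jensen's inequality: for fixed i the left side is the mean over y of a measurable function that
lies below the shifted ghost supremum. -/
lemma le_ghostDeviation {n : ℕ} (hh0 : ∀ i x, 0 ≤ h i x) (hhB : ∀ i x, h i x ≤ B)
    (hhm : ∀ i, Measurable (h i)) (z : Fin n → Ω) (i : I) :
    n * ∫ x, h i x ∂D - ∑ k, h i (z k) + 2 * n * B ≤ ghostDeviation D h B z := by
  have hB : 0 ≤ B := by
    have := nonempty_of_isProbabilityMeasure D
    exact (hh0 i (Classical.arbitrary Ω)).trans (hhB _ _)
  have hs : ∀ y : Fin n → Ω, signSum (fun k => h i (Sum.elim y z k)) (Sum.elim 1 (-1))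
      = ∑ k, h i (y k) - ∑ k, h i (z k) := by
    intro y
    simp [signSum, sub_eq_add_neg]
  have hle : ∀ y : Fin n → Ω, ∑ k, h i (y k) - ∑ k, h i (z k)
      ≤ signSup h (Sum.elim 1 (-1)) (Sum.elim y z) := fun y => by
    rw [← hs]; exact signSum_le_signSup hh0 hhB _ _ _
  have hge : ∀ y : Fin n → Ω, 0 ≤ ∑ k, h i (y k) - ∑ k, h i (z k) + 2 * n * B := fun y => by
    have := (abs_le.1 (abs_signSum_le_of_mem hh0 hhB (Sum.elim 1 (-1)) (Sum.elim y z) i)).1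
    rw [hs, Fintype.card_sum, Fintype.card_fin] at this
    push_cast at this
    linarith
  have hint : ∀ k : Fin n, Integrable (fun y : Fin n → Ω => h i (y k)) (Measure.pi fun _ => D) :=
    fun k => integrable_of_bounded ((hhm i).comp (measurable_pi_apply k)).aemeasurable
      (M := B) fun y => by rw [abs_of_nonneg (hh0 _ _)]; exact hhB _ _
  have hmean : ∫ y : Fin n → Ω, (∑ k, h i (y k) - ∑ k, h i (z k) + 2 * n * B)
      ∂(Measure.pi fun _ => D) = n * ∫ x, h i x ∂D - ∑ k, h i (z k) + 2 * n * B := by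
    have hsum := integrable_finsetSum univ fun k (_ : k ∈ univ) => hint k
    have hsub : Integrable (fun y : Fin n → Ω => ∑ k, h i (y k) - ∑ k, h i (z k))
        (Measure.pi fun _ => D) := hsum.sub (integrable_const _)
    rw [integral_add hsub (integrable_const _), integral_sub hsum (integrable_const _), integral_finsetSum _ fun k _ => hint k]
    have he : ∀ k : Fin n, ∫ y : Fin n → Ω, h i (y k) ∂(Measure.pi fun _ => D)
        = ∫ x, h i x ∂D := fun k =>
      integral_comp_measurePreserving (measurePreserving_eval (fun _ : Fin n => D) k)
        (hhm i).aemeasurable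
    simp [he]
  have hmeas : Measurable fun y : Fin n → Ω => ∑ k, h i (y k) - ∑ k, h i (z k) + 2 * n * B :=
    ((Finset.measurable_fun_sum _ fun k _ => (hhm i).comp (measurable_pi_apply k)).sub_const
      _).add_const _
  rw [← hmean, ← lowerMean_eq_integral hmeas.aemeasurable hge]
  have := lowerMean_le_add (D := Measure.pi fun _ : Fin n => D) (c := 0)
    (fun y => (ghost_nonneg_and_le hh0 hhB y z).2) le_rfl
    (u := fun y => ∑ k, h i (y k) - ∑ k, h i (z k) + 2 * n * B)
    (fun y => by linarith [hle y])
  rwa [add_zero] at this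

lemma integral_ghostDeviation_le {n : ℕ} (hh0 : ∀ i x, 0 ≤ h i x) (hhB : ∀ i x, h i x ≤ B)
    (hm : ∀ (m : ℕ) (σ : Fin m → ℤˣ), AEMeasurable (signSup h σ) (Measure.pi fun _ => D)) :
    ∫ z : Fin n → Ω, ghostDeviation D h B z ∂(Measure.pi fun _ => D)
      ≤ 2 * ∫ z : Fin n → Ω, 𝔼 σ, signSup h σ z ∂(Measure.pi fun _ => D) + 2 * n * B := by
  set P : Measure (Fin n → Ω) := Measure.pi fun _ => D with hP
  have hG := aemeasurable_ghost (n := n) hm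
  have hint : Integrable (fun p : (Fin n → Ω) × (Fin n → Ω) =>
      signSup h (Sum.elim 1 (-1)) (Sum.elim p.1 p.2)) (P.prod P) :=
    integrable_of_bounded hG fun _ => abs_signSup_le hh0 hhB _ _
  have hslice : ∀ᵐ z ∂P, ghostDeviation D h B z
      = ∫ y, (signSup h (Sum.elim 1 (-1)) (Sum.elim y z) + 2 * n * B) ∂P := by
    filter_upwards [hG.prod_swap.aestronglyMeasurable.prodMk_left] with z hz
    exact lowerMean_eq_integral (hz.aemeasurable.add_const _)
      fun y => (ghost_nonneg_and_le hh0 hhB y z).1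
  rw [integral_congr_ae hslice, ← integral_prod_symm
    (fun p : (Fin n → Ω) × (Fin n → Ω) =>
      signSup h (Sum.elim 1 (-1)) (Sum.elim p.1 p.2) + 2 * n * B)
    (hint.add (integrable_const _)), integral_add hint (integrable_const _)]
  have := integral_signSup_sumElim_le (n := n) hh0 hhB hm
  simp only [integral_const, probReal_univ, one_smul]
  linarith

/-- The uniform deviation bound with the expected Rademacher complexity. -/
lemma measure_exists_lt_le {n : ℕ} (hn : 0 < n) (hh0 : ∀ i x, 0 ≤ h i x)
    (hhB : ∀ i x, h i x ≤ B) (hhm : ∀ i, Measurable (h i))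
    (hm : ∀ (m : ℕ) (σ : Fin m → ℤˣ), AEMeasurable (signSup h σ) (Measure.pi fun _ => D))
    {δ : ℝ} (hδ : 0 < δ) (hδ1 : δ ≤ 1) :
    (Measure.pi fun _ => D) {z : Fin n → Ω | ∃ i, 1 / (n : ℝ) * ∑ k, h i (z k)
      + 2 * ∫ z : Fin n → Ω, familyRademacher h z ∂(Measure.pi fun _ => D)
      + B * √(Real.log (1 / δ) / (2 * n)) < ∫ x, h i x ∂D} ≤ ENNReal.ofReal δ := by
  have hn' : (0 : ℝ) < n := by exact_mod_cast hn
  have hB : 0 ≤ B := by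
    have := nonempty_of_isProbabilityMeasure D
    exact (hh0 (Classical.arbitrary I) (Classical.arbitrary Ω)).trans (hhB _ _)
  have h4B : (0 : ℝ) ≤ 4 * n * B := by positivity
  -- `ghostDeviation` is a sum and not an average, so its oscillation B in each coordinate is
  -- written as (n B)/n. The shift 2 n B appears in both estimates below and cancels.
  refine (measure_mono ?_).trans (measure_gt_le_of_boundedDifferences hn (B := n * B)
    (aemeasurable_ghostDeviation (B := B) hm) (fun _ => lowerMean_nonneg _)
    (fun z => lowerMean_le h4B fun y => (ghost_nonneg_and_le hh0 hhB y z).2)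
    (by positivity) (fun z k x => ?_) hδ hδ1)
  · rintro z ⟨i, hi⟩
    have h1 := le_ghostDeviation (D := D) hh0 hhB hhm z i
    have h2 := integral_ghostDeviation_le (n := n) hh0 hhB hm
    simp only [familyRademacher] at hi
    rw [integral_const_mul] at hi
    set E := ∫ z : Fin n → Ω, 𝔼 σ, signSup h σ z ∂(Measure.pi fun _ => D)
    have h3 : n * (1 / (n : ℝ) * ∑ k, h i (z k) + 2 * (1 / (n : ℝ) * E)
        + B * √(Real.log (1 / δ) / (2 * n))) < n * ∫ x, h i x ∂D := by gcongr
    have h4 : n * (1 / (n : ℝ) * ∑ k, h i (z k) + 2 * (1 / (n : ℝ) * E)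
        + B * √(Real.log (1 / δ) / (2 * n)))
        = ∑ k, h i (z k) + 2 * E + n * B * √(Real.log (1 / δ) / (2 * n)) := by
      field_simp
    simp only [Set.mem_ofPred_eq]
    linarith
  · rw [mul_div_cancel_left₀ _ hn'.ne']
    exact ghostDeviation_update_le hh0 hhB hB z k x

/-- The uniform deviation bound with the empirical Rademacher complexity. -/
lemma measure_exists_lt_empirical_le {n : ℕ} (hn : 0 < n) (hh0 : ∀ i x, 0 ≤ h i x)
    (hhB : ∀ i x, h i x ≤ B) (hhm : ∀ i, Measurable (h i))
    (hm : ∀ (m : ℕ) (σ : Fin m → ℤˣ), AEMeasurable (signSup h σ) (Measure.pi fun _ => D))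
    {δ : ℝ} (hδ : 0 < δ) (hδ1 : δ ≤ 1) :
    (Measure.pi fun _ => D) {z : Fin n → Ω | ∃ i, 1 / (n : ℝ) * ∑ k, h i (z k)
      + 2 * familyRademacher h z
      + 3 * B * √(Real.log (2 / δ) / (2 * n)) < ∫ x, h i x ∂D} ≤ ENNReal.ofReal δ := by
  have hB : 0 ≤ B := by
    have := nonempty_of_isProbabilityMeasure D
    exact (hh0 (Classical.arbitrary I) (Classical.arbitrary Ω)).trans (hhB _ _)
  have h1 := measure_exists_lt_le (D := D) hn hh0 hhB hhm hm (half_pos hδ) (by linarith)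
  have hR := aemeasurable_familyRademacher (n := n) hm
  -- The lower tail of the empirical complexity is an upper tail of B minus it, which keeps the
  -- function nonnegative. The deviation costs one error term and the doubled complexity two more,
  -- whence the factor 3; each event gets δ/2.
  have h2 := measure_gt_le_of_boundedDifferences (D := D) hn
    (g := fun z => B - familyRademacher h z) (M := B) (hR.const_sub B)
    (fun z => by linarith [familyRademacher_le hh0 hhB hn z])
    (fun z => by linarith [familyRademacher_nonneg hh0 hhB z]) hB
    (fun z k x => by
      have := familyRademacher_update_le hh0 hhB (Function.update z k x) k (z k)
      rw [Function.update_idem, Function.update_eq_self] at this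
      linarith) (half_pos hδ) (by linarith)
  have hint : Integrable (familyRademacher (n := n) h) (Measure.pi fun _ => D) :=
    integrable_of_bounded hR (M := B) fun z => by
      rw [abs_of_nonneg (familyRademacher_nonneg hh0 hhB z)]
      exact familyRademacher_le hh0 hhB hn z
  rw [integral_sub (integrable_const _) hint] at h2
  simp only [integral_const, probReal_univ, one_smul] at h2
  rw [show 1 / (δ / 2) = 2 / δ by field_simp] at h1 h2
  calc _ ≤ _ := measure_mono (t := _ ∪ _) ?_
    _ ≤ _ := measure_union_le _ _
    _ ≤ ENNReal.ofReal (δ / 2) + ENNReal.ofReal (δ / 2) := add_le_add h1 h2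
    _ = ENNReal.ofReal δ := by
      rw [← ENNReal.ofReal_add (by linarith) (by linarith), add_halves]
  rintro z ⟨i, hi⟩
  by_contra hz
  simp only [Set.mem_union, Set.mem_ofPred_eq, not_or, not_exists, not_lt] at hz
  linarith [hz.1 i, hz.2]

end Symmetrization

/-! ### From the margin losses to the SPO risk -/

section Generalization

open Finset
open scoped BigOperators

variable {X : Type*} {d n : ℕ} {S C : Set (Vec d)} {w : Vec d → Vec d} {μ γ B : ℝ}
  {H : Set (X → Vec d)}

lemma ereal_mul_mul_div (a b : ℝ) (r x : EReal) :
    (a : EReal) * r * x / (b : EReal) = ((a / b : ℝ) : EReal) * (r * x) := by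
  rw [EReal.div_eq_inv_mul, ← EReal.coe_inv, mul_assoc, ← mul_assoc, ← EReal.coe_mul,
    div_eq_inv_mul]

lemma norm_le_radius {c : Vec d} (hc : c ∈ C) : (‖c‖ : EReal) ≤ radius C :=
  le_iSup₂ (f := fun (c : Vec d) (_ : c ∈ C) => ((‖c‖ : ℝ) : EReal)) c hc

lemma radius_nonneg (hC : C.Nonempty) : 0 ≤ radius C := by
  obtain ⟨c, hc⟩ := hC
  exact (EReal.coe_nonneg.2 (norm_nonneg c)).trans (norm_le_radius hc)

lemma gap_le_gapSup {c : Vec d} (hc : c ∈ C) : (gap S c : EReal) ≤ gapSup S C :=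
  le_iSup₂ (f := fun (c : Vec d) (_ : c ∈ C) => ((gap S c : ℝ) : EReal)) c hc

lemma IsStronglyConvexSet.empMarginRademacher_le_radius (hS : IsStronglyConvexSet μ S)
    (hμ : 0 < μ) (hw : IsOracle S w) (hγ : 0 < γ) (hn : 0 < n) (hH : H.Nonempty)
    {z : Fin n → X × Vec d} (hz : ∀ i, (z i).2 ∈ C) :
    empMarginRademacher S w γ H z ≤
      ((5 * √2 / (γ * μ) : ℝ) : EReal) * (radius C * empRademacher H (fun i => (z i).1)) := by
  have : Nonempty (Fin n) := ⟨⟨0, hn⟩⟩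
  obtain ⟨k, hk⟩ := Finite.exists_max fun i => ‖(z i).2‖
  refine (hS.empMarginRademacher_le hμ hw hγ hn hH hk).trans ?_
  rw [mul_div_right_comm, EReal.coe_mul, mul_assoc]
  refine mul_le_mul_of_nonneg_left (mul_le_mul_of_nonneg_right (norm_le_radius (hz k))
    (empRademacher_nonneg hH _)) (EReal.coe_nonneg.2 (by positivity))

lemma ofReal_le_ofReal_mul_toENNReal {a b : ℝ} {e : EReal} (hb : 0 ≤ b)
    (h : (a : EReal) ≤ (b : EReal) * e) : ENNReal.ofReal a ≤ ENNReal.ofReal b * e.toENNReal := by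
  have h1 := EReal.toENNReal_le_toENNReal h
  rwa [EReal.toENNReal_mul (EReal.coe_nonneg.2 hb), EReal.real_coe_toENNReal,
    EReal.real_coe_toENNReal] at h1

/-- The margin loss of the predictors in `H`, set to zero outside of `T`. -/
noncomputable def clippedLoss (S : Set (Vec d)) (w : Vec d → Vec d) (γ : ℝ)
    (H : Set (X → Vec d)) (T : Set (X × Vec d)) (f : H) : X × Vec d → ℝ :=
  T.indicator fun z => marginLoss S w γ (f.1 z.1) z.2

variable {T : Set (X × Vec d)}

lemma IsOracle.clippedLoss_nonneg (hw : IsOracle S w) (hγ : 0 < γ) (f : H) (z : X × Vec d) :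
    0 ≤ clippedLoss S w γ H T f z :=
  Set.indicator_nonneg (fun _ _ => hw.marginLoss_nonneg hγ _ _) z

lemma IsOracle.clippedLoss_le (hw : IsOracle S w) (hγ : 0 < γ) (hB : 0 ≤ B)
    (hT : ∀ z ∈ T, gap S z.2 ≤ B) (f : H) (z : X × Vec d) : clippedLoss S w γ H T f z ≤ B :=
  Set.indicator_le' (fun z hz => (hw.marginLoss_le_gap hγ _ _).trans (hT z hz)) (fun _ _ => hB) z

lemma clippedLoss_of_mem (f : H) {z : X × Vec d} (hz : z ∈ T) :
    clippedLoss S w γ H T f z = marginLoss S w γ (f.1 z.1) z.2 :=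
  Set.indicator_of_mem hz _

lemma signSup_clippedLoss {m : ℕ} {z : Fin m → X × Vec d} (hz : ∀ k, z k ∈ T)
    (σ : Fin m → ℤˣ) : signSup (clippedLoss S w γ H T) σ z
      = ⨆ f : H, signSum (fun k => marginLoss S w γ (f.1 (z k).1) (z k).2) σ := by
  refine iSup_congr fun f => ?_
  simp only [clippedLoss_of_mem f (hz _)]

lemma IsOracle.familyRademacher_clippedLoss (hw : IsOracle S w) (hγ : 0 < γ) (hH : H.Nonempty)
    {z : Fin n → X × Vec d} (hz : ∀ k, z k ∈ T) :
    ((familyRademacher (clippedLoss S w γ H T) z : ℝ) : EReal)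
      = empMarginRademacher S w γ H z := by
  rw [hw.empMarginRademacher_eq hγ hH, familyRademacher, mul_expect]
  congr 1
  refine expect_congr rfl fun σ _ => ?_
  rw [signSup_clippedLoss hz, Real.mul_iSup_of_nonneg (by positivity)]

variable [MeasurableSpace X] {D : Measure (X × Vec d)} [IsProbabilityMeasure D]

lemma ae_pi_forall {Ω : Type*} [MeasurableSpace Ω] {D : Measure Ω} [IsProbabilityMeasure D]
    {p : Ω → Prop} (hp : ∀ᵐ x ∂D, p x) (n : ℕ) :
    ∀ᵐ z ∂(Measure.pi fun _ : Fin n => D), ∀ i, p (z i) := by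
  rw [ae_all_iff]
  intro i
  exact (measurePreserving_eval (fun _ : Fin n => D) i).quasiMeasurePreserving.ae hp

/-- Here g is a measurable version of the empirical complexity of the losses; the complexity of H
need not be measurable in the sample. -/
lemma IsStronglyConvexSet.lintegral_marginRademacher_le (hS : IsStronglyConvexSet μ S)
    (hμ : 0 < μ) (hw : IsOracle S w) (hγ : 0 < γ) (hn : 0 < n) (hH : H.Nonempty)
    (hDC : ∀ᵐ z ∂D, z.2 ∈ C) {g : (Fin n → X × Vec d) → ℝ}
    (hg : AEMeasurable g (Measure.pi fun _ => D))
    (hgR : ∀ᵐ z ∂(Measure.pi fun _ => D), (g z : EReal) = empMarginRademacher S w γ H z) :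
    ((∫⁻ z, ENNReal.ofReal (g z) ∂(Measure.pi fun _ => D) : ENNReal) : EReal) ≤
      ((5 * √2 / (γ * μ) : ℝ) : EReal) * (radius C * rademacher n D H) := by
  set P : Measure (Fin n → X × Vec d) := Measure.pi fun _ => D with hP
  have hC : C.Nonempty := by
    obtain ⟨z, hz⟩ := hDC.exists
    exact ⟨_, hz⟩
  have hr0 := radius_nonneg hC
  have hall := ae_pi_forall hDC n
  rw [rademacher]
  set r := ∫⁻ z, (empRademacher H fun i => (z i).1).toENNReal ∂P with hr
  have hbound : ∀ (a : (Fin n → X × Vec d) → ℝ), (∀ z i, ‖(z i).2‖ ≤ a z) →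
      ∀ᵐ z ∂P, ENNReal.ofReal (g z) ≤ ENNReal.ofReal (5 * √2 * a z / (γ * μ))
        * (empRademacher H fun i => (z i).1).toENNReal := by
    intro a ha
    filter_upwards [hgR] with z hz
    have h0 : 0 ≤ a z := (norm_nonneg _).trans (ha z ⟨0, hn⟩)
    exact ofReal_le_ofReal_mul_toENNReal (by positivity)
      (hz ▸ hS.empMarginRademacher_le hμ hw hγ hn hH (ha z))
  by_cases htop : radius C = ⊤
  · rcases eq_or_ne r 0 with h0 | h0
    -- The case ∞ · 0. A vanishing lower integral does not make a nonmeasurable integrand vanish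
    -- almost everywhere, so the sample-dependent bound a, finite and positive by the added 1, is
    -- divided out on the side of the measurable g.
    · let a : (Fin n → X × Vec d) → ℝ := fun z => ∑ i, ‖(z i).2‖ + 1
      have ha : ∀ z i, ‖(z i).2‖ ≤ a z := fun z i =>
        (single_le_sum (f := fun i => ‖(z i).2‖) (fun _ _ => norm_nonneg _) (mem_univ i)).trans
          (by simp [a])
      have hapos : ∀ z, 0 < 5 * √2 * a z / (γ * μ) := fun z => by
        have : 0 < a z := by positivity
        positivity
      have ham : Measurable fun z => 5 * √2 * a z / (γ * μ) := by fun_prop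
      have hle : ∫⁻ z, ENNReal.ofReal (g z) / ENNReal.ofReal (5 * √2 * a z / (γ * μ)) ∂P ≤ r := by
        refine lintegral_mono_ae ?_
        filter_upwards [hbound a ha] with z hz
        rw [ENNReal.div_le_iff (ENNReal.ofReal_pos.2 (hapos z)).ne' ENNReal.ofReal_ne_top,
          mul_comm]
        exact hz
      have hdiv : AEMeasurable
          (fun z => ENNReal.ofReal (g z) / ENNReal.ofReal (5 * √2 * a z / (γ * μ))) P :=
        hg.ennreal_ofReal.div ham.ennreal_ofReal.aemeasurable
      rw [h0, nonpos_iff_eq_zero, lintegral_eq_zero_iff' hdiv] at hle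
      have hz : ∫⁻ z, ENNReal.ofReal (g z) ∂P = 0 := by
        rw [lintegral_eq_zero_iff' hg.ennreal_ofReal]
        filter_upwards [hle] with z hz
        rcases ENNReal.div_eq_zero_iff.1 hz with h | h
        · exact h
        · exact absurd h ENNReal.ofReal_ne_top
      rw [hz, h0]
      simp
    · have hpos : (0 : EReal) < r := by
        rw [EReal.coe_ennreal_pos]
        exact pos_iff_ne_zero.2 h0
      rw [htop, EReal.top_mul_of_pos hpos, EReal.coe_mul_top_of_pos (by positivity)]
      exact le_top
  · obtain ⟨ρ, hρ⟩ : ∃ ρ : ℝ, radius C = ρ :=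
      ⟨_, (EReal.coe_toReal htop (ne_bot_of_le_ne_bot EReal.zero_ne_bot hr0)).symm⟩
    rw [hρ] at hr0 ⊢
    have hρ0 : 0 ≤ ρ := EReal.coe_nonneg.1 hr0
    have hle : ∫⁻ z, ENNReal.ofReal (g z) ∂P ≤ ENNReal.ofReal (5 * √2 / (γ * μ) * ρ) * r := by
      rw [hr, ← lintegral_const_mul' _ _ ENNReal.ofReal_ne_top]
      refine lintegral_mono_ae ?_
      filter_upwards [hgR, hall] with z hz hzC
      refine ofReal_le_ofReal_mul_toENNReal (by positivity) ?_
      rw [hz, EReal.coe_mul, mul_assoc, ← hρ]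
      exact hS.empMarginRademacher_le_radius hμ hw hγ hn hH hzC
    refine (EReal.coe_ennreal_le_coe_ennreal_iff.2 hle).trans (le_of_eq ?_)
    rw [EReal.coe_ennreal_mul, EReal.coe_ennreal_ofReal, max_eq_left (by positivity),
      EReal.coe_mul, mul_assoc]

lemma HoldsWithProb.of_measure_le {Ω : Type*} [MeasurableSpace Ω] {P : Measure Ω}
    [IsProbabilityMeasure P] {δ : ℝ} (hδ : 0 ≤ δ) {Q : Ω → Prop}
    (h : P {z | ¬ Q z} ≤ ENNReal.ofReal δ) : HoldsWithProb P (1 - δ) Q := by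
  refine ⟨(toMeasurable P {z | ¬ Q z})ᶜ, (measurableSet_toMeasurable _ _).compl, ?_, ?_⟩
  · rw [prob_compl_eq_one_sub (measurableSet_toMeasurable _ _), measure_toMeasurable,
      ENNReal.ofReal_sub _ hδ, ENNReal.ofReal_one]
    gcongr
  · intro z hz
    by_contra hQ
    exact hz (subset_toMeasurable _ _ hQ)

lemma IsOracle.aemeasurable_signSup_clippedLoss (hw : IsOracle S w) (hγ : 0 < γ)
    (hH : H.Nonempty) (hTD : ∀ᵐ z ∂D, z ∈ T) (hm : HasMeasurableSups S w γ D H) (m : ℕ)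
    (σ : Fin m → ℤˣ) :
    AEMeasurable (signSup (clippedLoss S w γ H T) σ) (Measure.pi fun _ => D) := by
  refine (hm m σ).ereal_toReal.congr ?_
  filter_upwards [ae_pi_forall hTD m] with z hz
  have h := hw.iSup_signed_marginLoss hγ hH z σ 1
  simp only [one_mul] at h
  rw [h, EReal.toReal_coe, signSup_clippedLoss hz]

lemma IsStronglyConvexSet.measurable_clippedLoss (hS : IsStronglyConvexSet μ S) (hμ : 0 < μ)
    (hw : IsOracle S w) (hγ : 0 < γ) (hTm : MeasurableSet T) (hHm : ∀ f ∈ H, Measurable f)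
    (f : H) : Measurable (clippedLoss S w γ H T f) :=
  ((hS.measurable_marginLoss hμ hw hγ).comp
    (((hHm f.1 f.2).comp measurable_fst).prodMk measurable_snd)).indicator hTm

lemma IsStronglyConvexSet.spoRisk_le_integral_clippedLoss (hS : IsStronglyConvexSet μ S)
    (hμ : 0 < μ) (hw : IsOracle S w) (hγ : 0 < γ) (hTm : MeasurableSet T)
    (hTD : ∀ᵐ z ∂D, z ∈ T) (hB : 0 ≤ B) (hT : ∀ z ∈ T, gap S z.2 ≤ B)
    (hHm : ∀ f ∈ H, Measurable f) (f : H) :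
    spoRisk w D f.1 ≤ ∫ z, clippedLoss S w γ H T f z ∂D := by
  have hwm := hS.measurable_oracle hμ hw
  have hfm := hHm f.1 f.2
  have hmeas : Measurable fun z : X × Vec d => spoLoss w (f.1 z.1) z.2 := by
    simp only [spoLoss]
    fun_prop
  have hint : Integrable (fun z => spoLoss w (f.1 z.1) z.2) D := by
    refine Integrable.of_bound hmeas.aestronglyMeasurable B (hTD.mono fun z hz => ?_)
    rw [Real.norm_of_nonneg (hw.spoLoss_nonneg (f.1 z.1) z.2)]
    exact (hw.spoLoss_le_gap (f.1 z.1) z.2).trans (hT z hz)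
  have hclip : Integrable (clippedLoss S w γ H T f) D := by
    refine integrable_of_bounded (M := B)
      (hS.measurable_clippedLoss hμ hw hγ hTm hHm f).aemeasurable fun z => ?_
    rw [abs_of_nonneg (hw.clippedLoss_nonneg hγ f z)]
    exact hw.clippedLoss_le hγ hB hT f z
  rw [spoRisk]
  exact integral_mono_ae hint hclip (hTD.mono fun z hz =>
    (hw.spoLoss_le_marginLoss hγ (f.1 z.1) z.2).trans_eq (clippedLoss_of_mem f hz).symm)

lemma IsStronglyConvexSet.generalization_of_bounded (hS : IsStronglyConvexSet μ S)
    (hμ : 0 < μ) (hw : IsOracle S w) (hγ : 0 < γ) (hn : 0 < n) (hH : H.Nonempty)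
    (hDC : ∀ᵐ z ∂D, z.2 ∈ C) (hHm : ∀ f ∈ H, Measurable f) (hm : HasMeasurableSups S w γ D H)
    (hB : 0 ≤ B) (hCB : ∀ c ∈ C, gap S c ≤ B) {δ : ℝ} (hδ : 0 < δ) (hδ1 : δ ≤ 1) :
    HoldsWithProb (Measure.pi fun _ : Fin n => D) (1 - δ) (fun z =>
      ∀ f ∈ H, ((spoRisk w D f : ℝ) : EReal) ≤
        ((empMarginRisk S w γ z f : ℝ) : EReal)
          + ((10 * √2 : ℝ) : EReal) * radius C * rademacher n D H / ((γ * μ : ℝ) : EReal)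
          + (B : EReal) * ((√(Real.log (1 / δ) / (2 * n)) : ℝ) : EReal)) ∧
    HoldsWithProb (Measure.pi fun _ : Fin n => D) (1 - δ) (fun z =>
      ∀ f ∈ H, ((spoRisk w D f : ℝ) : EReal) ≤
        ((empMarginRisk S w γ z f : ℝ) : EReal)
          + ((10 * √2 : ℝ) : EReal) * radius C * empRademacher H (fun i => (z i).1)
            / ((γ * μ : ℝ) : EReal)
          + 3 * (B : EReal) * ((√(Real.log (2 / δ) / (2 * n)) : ℝ) : EReal)) := by
  have := hH.to_subtype
  set P : Measure (Fin n → X × Vec d) := Measure.pi fun _ => D with hP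
  -- C need not be measurable: T is the complement of a measurable hull of the null event that the
  -- cost leaves C.
  set T : Set (X × Vec d) := (toMeasurable D {z | ¬ z.2 ∈ C})ᶜ with hTdef
  have hTm : MeasurableSet T := (measurableSet_toMeasurable _ _).compl
  have hTD : ∀ᵐ z ∂D, z ∈ T := by
    rw [ae_iff]
    simp only [hTdef, Set.mem_compl_iff, not_not, Set.ofPred_mem_eq, measure_toMeasurable]
    exact hDC
  have hTC : ∀ z ∈ T, z.2 ∈ C := fun z hz => by
    by_contra hzC
    exact hz (subset_toMeasurable _ _ hzC)
  have hTB : ∀ z ∈ T, gap S z.2 ≤ B := fun z hz => hCB _ (hTC z hz)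
  set h := clippedLoss S w γ H T with hh
  have hh0 : ∀ f z, 0 ≤ h f z := hw.clippedLoss_nonneg hγ
  have hhB : ∀ f z, h f z ≤ B := hw.clippedLoss_le hγ hB hTB
  have hhm := hS.measurable_clippedLoss hμ hw hγ hTm hHm
  have hsup := hw.aemeasurable_signSup_clippedLoss hγ hH hTD hm
  have hTall := ae_pi_forall hTD n
  have hrisk := hS.spoRisk_le_integral_clippedLoss hμ hw hγ hTm hTD hB hTB hHm
  have hemp : ∀ z : Fin n → X × Vec d, (∀ k, z k ∈ T) → ∀ f : H,
      1 / (n : ℝ) * ∑ k, h f (z k) = empMarginRisk S w γ z f.1 := by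
    intro z hz f
    simp only [hh, empMarginRisk, clippedLoss_of_mem f (hz _)]
  have hR0 := familyRademacher_nonneg (n := n) hh0 hhB
  have hRm := aemeasurable_familyRademacher (n := n) hsup
  have hdouble : ∀ (a : ℝ) (r x : EReal),
      (a : EReal) ≤ ((5 * √2 / (γ * μ) : ℝ) : EReal) * (r * x) →
      ((2 * a : ℝ) : EReal) ≤ ((10 * √2 : ℝ) : EReal) * r * x / ((γ * μ : ℝ) : EReal) := by
    intro a r x hle
    rw [ereal_mul_mul_div, show 10 * √2 / (γ * μ) = 2 * (5 * √2 / (γ * μ)) by ring, EReal.coe_mul,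
      EReal.coe_mul 2 (5 * √2 / (γ * μ)), mul_assoc]
    exact mul_le_mul_of_nonneg_left hle (EReal.coe_nonneg.2 zero_le_two)
  constructor
  · refine HoldsWithProb.of_measure_le hδ.le
      ((measure_mono_ae ?_).trans (measure_exists_lt_le (D := D) hn hh0 hhB hhm hsup hδ hδ1))
    have hRad : ((∫ z, familyRademacher h z ∂P : ℝ) : EReal)
        ≤ ((5 * √2 / (γ * μ) : ℝ) : EReal) * (radius C * rademacher n D H) := by
      refine le_trans (le_of_eq ?_) (hS.lintegral_marginRademacher_le hμ hw hγ hn hH hDC hRm ?_)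
      · rw [← ofReal_integral_eq_lintegral_ofReal _ (Filter.Eventually.of_forall hR0),
          EReal.coe_ennreal_ofReal, max_eq_left (integral_nonneg hR0)]
        refine integrable_of_bounded hRm (M := B) fun z => ?_
        rw [abs_of_nonneg (hR0 z)]
        exact familyRademacher_le hh0 hhB hn z
      · filter_upwards [hTall] with z hz
        exact hw.familyRademacher_clippedLoss hγ hH hz
    filter_upwards [hTall] with z hz hnot
    by_contra hcon
    replace hcon := fun f : H => not_lt.1 (not_exists.1 hcon f)
    refine hnot fun f hf => ?_
    have h1 := (hrisk ⟨f, hf⟩).trans (hcon ⟨f, hf⟩)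
    rw [hemp z hz] at h1
    refine (EReal.coe_le_coe_iff.2 h1).trans ?_
    rw [EReal.coe_add, EReal.coe_add, EReal.coe_mul B]
    gcongr
    exact hdouble _ _ _ hRad
  · refine HoldsWithProb.of_measure_le hδ.le ((measure_mono_ae ?_).trans
      (measure_exists_lt_empirical_le (D := D) hn hh0 hhB hhm hsup hδ hδ1))
    filter_upwards [hTall] with z hz hnot
    by_contra hcon
    replace hcon := fun f : H => not_lt.1 (not_exists.1 hcon f)
    refine hnot fun f hf => ?_
    have h1 := (hrisk ⟨f, hf⟩).trans (hcon ⟨f, hf⟩)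
    rw [hemp z hz] at h1
    refine (EReal.coe_le_coe_iff.2 h1).trans ?_
    rw [EReal.coe_add, EReal.coe_add, EReal.coe_mul (3 * B), EReal.coe_mul 3 B]
    gcongr
    · refine hdouble _ _ _ ?_
      rw [hw.familyRademacher_clippedLoss hγ hH hz]
      exact hS.empMarginRademacher_le_radius hμ hw hγ hn hH fun i => hTC _ (hz i)
    · exact le_rfl

lemma holdsWithProb_of_nonpos {Ω : Type*} [MeasurableSpace Ω] {P : Measure Ω} {p : ℝ}
    (hp : p ≤ 0) (Q : Ω → Prop) : HoldsWithProb P p Q :=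
  ⟨∅, MeasurableSet.empty, by simp [ENNReal.ofReal_of_nonpos hp], by simp⟩

lemma holdsWithProb_of_forall {Ω : Type*} [MeasurableSpace Ω] {P : Measure Ω}
    [IsProbabilityMeasure P] {p : ℝ} (hp : p ≤ 1) {Q : Ω → Prop} (hQ : ∀ z, Q z) :
    HoldsWithProb P p Q :=
  ⟨Set.univ, MeasurableSet.univ, by simpa using hp, fun z _ => hQ z⟩

end Generalization

end SPO

theorem theorem4 {X : Type*} [MeasurableSpace X] {d n : ℕ} (hn : 0 < n)
    (S : Set (SPO.Vec d)) (hSne : S.Nonempty) (hScpt : IsCompact S)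
    (μ : ℝ) (hμ : 0 < μ) (hS : SPO.IsStronglyConvexSet μ S)
    (w : SPO.Vec d → SPO.Vec d) (hw : SPO.IsOracle S w)
    (C : Set (SPO.Vec d)) (γ : ℝ) (hγ : 0 < γ)
    (H : Set (X → SPO.Vec d)) (hH : H.Nonempty) :
    (∀ z : Fin n → X × SPO.Vec d, (∀ i, (z i).2 ∈ C) →
      SPO.empMarginRademacher S w γ H z ≤
        ((5 * √2 : ℝ) : EReal) * SPO.radius C * SPO.empRademacher H (fun i => (z i).1)
          / ((γ * μ : ℝ) : EReal)) ∧
    (∀ D : MeasureTheory.Measure (X × SPO.Vec d), MeasureTheory.IsProbabilityMeasure D →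
      (∀ᵐ z ∂D, z.2 ∈ C) → (∀ f ∈ H, Measurable f) → SPO.HasMeasurableSups S w γ D H →
      ∀ δ : ℝ, 0 < δ →
        SPO.HoldsWithProb (MeasureTheory.Measure.pi fun _ : Fin n => D) (1 - δ) (fun z =>
          ∀ f ∈ H, ((SPO.spoRisk w D f : ℝ) : EReal) ≤
            ((SPO.empMarginRisk S w γ z f : ℝ) : EReal)
              + ((10 * √2 : ℝ) : EReal) * SPO.radius C * SPO.rademacher n D H
                / ((γ * μ : ℝ) : EReal)
              + SPO.gapSup S C * ((√(Real.log (1 / δ) / (2 * n)) : ℝ) : EReal)) ∧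
        SPO.HoldsWithProb (MeasureTheory.Measure.pi fun _ : Fin n => D) (1 - δ) (fun z =>
          ∀ f ∈ H, ((SPO.spoRisk w D f : ℝ) : EReal) ≤
            ((SPO.empMarginRisk S w γ z f : ℝ) : EReal)
              + ((10 * √2 : ℝ) : EReal) * SPO.radius C * SPO.empRademacher H (fun i => (z i).1)
                / ((γ * μ : ℝ) : EReal)
              + 3 * SPO.gapSup S C * ((√(Real.log (2 / δ) / (2 * n)) : ℝ) : EReal))) := by
  have hpos : 0 < γ * μ := mul_pos hγ hμ
  refine ⟨fun z hz => ?_, fun D hD hDC hHm hm δ hδ => ?_⟩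
  · rw [SPO.ereal_mul_mul_div]
    exact hS.empMarginRademacher_le_radius hμ hw hγ hn hH hz
  rcases le_or_gt 1 δ with hδ1 | hδ1
  · exact ⟨SPO.holdsWithProb_of_nonpos (by linarith) _,
      SPO.holdsWithProb_of_nonpos (by linarith) _⟩
  obtain ⟨z₀, hz₀⟩ := hDC.exists
  have hr0 : 0 ≤ SPO.radius C := SPO.radius_nonneg ⟨_, hz₀⟩
  have hg0 : 0 ≤ SPO.gapSup S C :=
    (EReal.coe_nonneg.2 (hw.gap_nonneg z₀.2)).trans (SPO.gap_le_gapSup hz₀)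
  by_cases htop : SPO.gapSup S C = ⊤
  -- Now δ < 1, so both square roots are positive and the last summand is +∞. Since ⊥ + ⊤ = ⊥, the
  -- remaining summands still have to be kept away from −∞.
  · have hn' : (0 : ℝ) < n := by exact_mod_cast hn
    have hterm : ∀ (a : ℝ) (x : EReal), 0 ≤ x → (a : EReal)
        + ((10 * √2 : ℝ) : EReal) * SPO.radius C * x / ((γ * μ : ℝ) : EReal) ≠ ⊥ := by
      intro a x hx
      rw [SPO.ereal_mul_mul_div, EReal.add_ne_bot_iff]
      exact ⟨EReal.coe_ne_bot a, ne_bot_of_le_ne_bot EReal.zero_ne_bot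
        (mul_nonneg (EReal.coe_nonneg.2 (by positivity)) (mul_nonneg hr0 hx))⟩
    have hsqrt : ∀ b : ℝ, 1 ≤ b → (0 : ℝ) < √(Real.log (b / δ) / (2 * n)) := by
      intro b hb
      have : 0 < Real.log (b / δ) := Real.log_pos (by rw [lt_div_iff₀ hδ]; linarith)
      positivity
    constructor
    · refine SPO.holdsWithProb_of_forall (by linarith) fun z f hf => ?_
      rw [htop, EReal.top_mul_coe_of_pos (hsqrt 1 le_rfl), EReal.add_top_of_ne_bot]
      · exact le_top
      · exact hterm _ _ (EReal.coe_ennreal_nonneg _)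
    · refine SPO.holdsWithProb_of_forall (by linarith) fun z f hf => ?_
      rw [htop, EReal.mul_top_of_pos (by norm_num),
        EReal.top_mul_coe_of_pos (hsqrt 2 (by norm_num)), EReal.add_top_of_ne_bot]
      · exact le_top
      · exact hterm _ _ (SPO.empRademacher_nonneg hH _)
  · obtain ⟨B, hB⟩ : ∃ B : ℝ, SPO.gapSup S C = B :=
      ⟨_, (EReal.coe_toReal htop (ne_bot_of_le_ne_bot EReal.zero_ne_bot hg0)).symm⟩
    rw [hB] at hg0 ⊢
    exact hS.generalization_of_bounded hμ hw hγ hn hH hDC hHm hm (EReal.coe_nonneg.1 hg0)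
      (fun c hc => EReal.coe_le_coe_iff.1 (hB ▸ SPO.gap_le_gapSup hc)) hδ hδ1.le
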